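/- Let $n,m\ge 0$ be integers with $d=n+m\ge 1$, and equip $\mathbb{R}^d=\mathbb{R}^n\times\mathbb{R}^m$ with the Euclidean norm; write $z=(x,y)$. Let $f:\mathbb{R}^d\to\mathbb{R}$ satisfy $|f(z)-f(w)|\le L_0\|z-w\|$ for all $z,w$, where $L_0>0$. For $\mu>0$ let $$f_\mu(z)=\frac1\psi\int_{\mathbb{R}^d}f(z+\mu u)e^{-\|u\|^2/2}\,du,\quad \psi=\int_{\mathbb{R}^d} e^{-\|u\|^2/2}\,du,\quad F_\mu(z)=\begin{bmatrix}\nabla_xf_\mu(z)\\-\nabla_yf_\mu(z)\end{bmatrix},\quad G_\mu(z;u)=\frac{f(z+\mu u)-f(z)}{\mu}\begin{bmatrix}u_1\\-u_2\end{bmatrix}$$ for $u=(u_1,u_2)\in\mathbb{R}^n\times\mathbb{R}^m$. Let $L_1>0$ be a Lipschitz constant of $\nabla f_\mu$, and let $\sigma\in\mathbb{R}$ be such that $E_{u\sim\mathcal N(0,I)}\|G_\mu(z;u)-F_\mu(z)\|^2\le\sigma^2$ for all $z$. Let $\rho\in[0,\frac1{4L_1})$ and $z^\ast\in\mathbb{R}^d$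 satisfy the weak Minty variational inequality $$\langle F_\mu(z),z-z^\ast\rangle+\tfrac{\rho}{2}\|F_\mu(z)\|^2\ge0\qquad\text{for all }z\in\mathbb{R}^d.$$ Let $\partial f(z)=\{g:\langle g,v\rangle\le f^\circ(z;v)\ \forall v\}$ with $f^\circ(z;v)=\limsup_{z'\to z,\,t\downarrow0}\frac{f(z'+tv)-f(z')}{t}$ be the generalised gradient of $f$, and let $\partial_\delta f(z)=\operatorname{conv}\bigcup_{\|z'-z\|\le\delta}\partial f(z')$ be its $\delta$-Goldstein subdifferential. Let $0<\delta<1$, $\epsilon>0$, $z_0\in\mathbb{R}^d$, $r_0=\|z_0-z^\ast\|$, $h_1\le\frac1{L_1}$, $h_2\in\big(\sqrt{\rho/L_1},\frac{h_1}2\big]$. Let $N\ge0$ and $t\ge1$ be integers, and suppose that $$\mu\le\frac{\delta}{\sqrt{d\pi e}}\Big(\frac{\epsilon}{8L_0}\Big)^{1/d},\qquad N\ge\Big\lceil\frac{16r_0^2L_1}{L_1h_2^2-\rho}\epsilon^{-2}-1\Big\rceil,\qquad t\ge\Big\lceil\frac{24\sigma^2}{L_1(L_1h_2^2-\rho)}\epsilon^{-2}\Big\rceil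 .$$ Consider the (unconstrained) variance-reduced zeroth-order extragradient iteration, for $k=0,\dots,N$, $$\hat z_k=z_k-\frac{h_1}{t}\sum_{i=1}^{t}G_\mu(z_k;\hat u_k^i),\qquad z_{k+1}=z_k-\frac{h_2}{t}\sum_{i=1}^{t}G_\mu(\hat z_k;u_k^i),$$ where all the directions $\hat u_k^i,u_k^i$ ($0\le k\le N$, $1\le i\le t$) are independent with law $\mathcal N(0,I)$. Then $\nabla f_\mu$ is Lipschitz with constant $\frac{d^{1/2}}{\mu}L_0$ (so that the choice $L_1=\frac{d^{1/2}}{\mu}L_0$ is always allowed above), and there is $k\in\{0,\dots,N\}$ such that $\hat z_k$ is a $(\delta,\epsilon)$-Goldstein stationary point of $f$ in the expected sense: $\min\{\|g\|:g\in\partial_\delta f(\hat z_k)\}$ is a random variable and $$E\big[\min\{\|g\|:g\in\partial_\delta f(\hat z_k)\}\big]\le\epsilon .$$ -/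

import Mathlib

open MeasureTheory ProbabilityTheory Filter Topology
open scoped ENNReal InnerProductSpace Gradient

noncomputable section

namespace ZOEG

/-- The Euclidean space `ℝⁿ × ℝᵐ = ℝᵈ`, `d = n + m`, of pairs `z = (x, y)`: the coordinates indexed
by `Sum.inl` form the block `x` and those indexed by `Sum.inr` form the block `y`. -/
abbrev Z (n m : ℕ) : Type := EuclideanSpace ℝ (Fin n ⊕ Fin m)

variable {n m : ℕ}

/-- The map `(x, y) ↦ (x, -y)`. -/
def signFlip (v : Z n m) : Z n m :=
  WithLp.toLp 2 (Sum.elim (fun i => v (Sum.inl i)) (fun j => -v (Sum.inr j)))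

/-- Clarke's generalised directional derivative
`f°(z; v) = limsup_{z' → z, t ↓ 0} (f (z' + t v) - f z') / t`. -/
def clarkeDeriv (f : Z n m → ℝ) (z v : Z n m) : ℝ :=
  limsup (fun p : Z n m × ℝ => (f (p.1 + p.2 • v) - f p.1) / p.2) (𝓝 z ×ˢ 𝓝[>] (0 : ℝ))

/-- The generalised gradient `∂f(z)`. -/
def generalisedGradient (f : Z n m → ℝ) (z : Z n m) : Set (Z n m) :=
  {g | ∀ v, ⟪g, v⟫_ℝ ≤ clarkeDeriv f z v}

/-- The `δ`-Goldstein subdifferential `∂_δ f(z)`. -/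
def goldsteinSubdifferential (f : Z n m → ℝ) (δ : ℝ) (z : Z n m) : Set (Z n m) :=
  convexHull ℝ (⋃ z' ∈ Metric.closedBall z δ, generalisedGradient f z')

/-- `dist(0, ∂_δ f(z)) = min {‖g‖ : g ∈ ∂_δ f(z)}`, with value `∞` if `∂_δ f(z)` were empty. -/
def goldsteinResidual (f : Z n m → ℝ) (δ : ℝ) (z : Z n m) : ℝ≥0∞ :=
  ⨅ g ∈ goldsteinSubdifferential f δ z, ‖g‖ₑ

/-- The random point `X` is a `(δ, ε)`-Goldstein stationary point of `f` in the expected sense: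
`dist(0, ∂_δ f(X))` is a random variable and its expectation is at most `ε`. -/
def IsGoldsteinStationaryInExpectation {Ω : Type*} [MeasurableSpace Ω] (P : Measure Ω)
    (f : Z n m → ℝ) (δ ε : ℝ) (X : Ω → Z n m) : Prop :=
  AEMeasurable (fun ω => goldsteinResidual f δ (X ω)) P ∧
    ∫⁻ ω, goldsteinResidual f δ (X ω) ∂P ≤ ENNReal.ofReal ε

/-- The Gaussian smoothing `f_μ(z) = (1/ψ) ∫ f(z + μ u) exp(-‖u‖² / 2) du`, where
`ψ = ∫ exp(-‖u‖² / 2) du` (the case `B = I`). -/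
def smoothed (f : Z n m → ℝ) (μ : ℝ) (z : Z n m) : ℝ :=
  (∫ u : Z n m, Real.exp (-‖u‖ ^ 2 / 2))⁻¹ *
    ∫ u : Z n m, f (z + μ • u) * Real.exp (-‖u‖ ^ 2 / 2)

/-- The operator `F_μ(z) = (∇ₓ f_μ(z), -∇_y f_μ(z))`. -/
def smoothedOperator (f : Z n m → ℝ) (μ : ℝ) (z : Z n m) : Z n m :=
  signFlip (∇ (smoothed f μ) z)

/-- The Gaussian oracle along the direction `u = (u₁, u₂)`:
`G_μ(z) = ((f(z + μ u) - f(z)) / μ) (u₁, -u₂)` (the case `B = I`). -/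
def oracle (f : Z n m → ℝ) (μ : ℝ) (z u : Z n m) : Z n m :=
  ((f (z + μ • u) - f z) / μ) • signFlip u

/-- The variance-reduced oracle: the average of `G_μ(z)` over the `t` directions `u i`. -/
def averagedOracle (f : Z n m → ℝ) (μ : ℝ) {t : ℕ} (z : Z n m) (u : Fin t → Z n m) : Z n m :=
  (t : ℝ)⁻¹ • ∑ i, oracle f μ z (u i)

/-- One extrapolation `ẑ = z - h₁ G_μ(z)` with the directions `uhat` (there is no constraint, so
the projection is the identity). -/
def extrapolate (f : Z n m → ℝ) (μ h₁ : ℝ) {t : ℕ} (z : Z n m) (uhat : Fin t → Z n m) : Z n m :=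
  z - h₁ • averagedOracle f μ z uhat

/-- The iterates `z_k` of the unconstrained variance-reduced zeroth-order extragradient method, with
constant step sizes and `t` directions per oracle call; the directions `uhat k` are used at `z_k` and
the directions `u k` at `ẑ_k`:
`ẑ_k = z_k - h₁ G_μ(z_k)`, `z_{k+1} = z_k - h₂ G_μ(ẑ_k)`. -/
def iterate (f : Z n m → ℝ) (μ h₁ h₂ : ℝ) {t : ℕ} (z₀ : Z n m) (uhat u : ℕ → Fin t → Z n m) :
    ℕ → Z n m
  | 0 => z₀
  | k + 1 =>
    iterate f μ h₁ h₂ z₀ uhat u k -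
      h₂ • averagedOracle f μ
        (extrapolate f μ h₁ (iterate f μ h₁ h₂ z₀ uhat u k) (uhat k)) (u k)

/-- The extrapolated iterates `ẑ_k = z_k - h₁ G_μ(z_k)`. -/
def iterateHat (f : Z n m → ℝ) (μ h₁ h₂ : ℝ) {t : ℕ} (z₀ : Z n m) (uhat u : ℕ → Fin t → Z n m)
    (k : ℕ) : Z n m :=
  extrapolate f μ h₁ (iterate f μ h₁ h₂ z₀ uhat u k) (uhat k)

end ZOEG

end

/-!
The iteration is stochastic extragradient for the smooth operator `F_μ`, and near-stationarity for
`f_μ` is near-Goldstein-stationarity for `f`.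

*Smoothing.* Since `f` is Lipschitz, `∇f_μ(z)` has two expressions as a Gaussian expectation. By
Rademacher's theorem and differentiation under the integral sign it is the average of
`∇f(z + μu)` (`gradient_smoothed_eq_integral_gradient`); by differentiating the Cameron–Martin
shift it is the average of `μ⁻¹ f(z + μu) u` (`smul_gradient_smoothed`). The second expression
shows that the oracle is unbiased (`integral_oracle`) and that `∇f_μ` is Lipschitz with constant
`√d L₀ / μ`, because `E‖u‖ ≤ √d` (`norm_gradient_smoothed_sub_le`).

*From `f_μ` to `f`.* Averaging `∇f(z + μu)` only over `‖μu‖ ≤ δ` gives an element of the closed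
convex hull `closure (∂_δ f(z))`; it differs from `∇f_μ(z)` by at most `2 L₀ P(‖μu‖ > δ)`, and a
Chernoff bound together with the choice of `μ` makes this at most `ε / 4` (`goldsteinResidual_le`).
Passing to the closure is harmless since the residual is an infimum of norms. The residual is lower
semicontinuous in `z`, hence measurable (`lowerSemicontinuous_goldsteinResidual`).

*The method.* In one step the error `ξ` of the first oracle call enters the decrease of
`‖z - z*‖²` through `‖ξ‖²` and through `⟪F(ẑ) - F(z), ξ⟫`. Comparing `ẑ` with the noiseless
extrapolation `z - h₁ F(z)` turns the latter into another multiple of `‖ξ‖²` plus a term with mean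
zero (`sq_norm_extragradient_le`); this is why `h₁ = 1 / L₁` is allowed. Hence
`E‖z_{k+1} - z*‖² + (h₂² - ρ / L₁) E‖F_μ(ẑ_k)‖² ≤ E‖z_k - z*‖² + (3 h₁ h₂ + h₂²) σ² / t`
(`integral_step_le`), the directions of step `k` being independent of `z_k`
(`indepFun_iterate`). Telescoping gives a `k` with `E‖F_μ(ẑ_k)‖² ≤ ε² / 4`
(`exists_integral_sq_norm_smoothedOperator_le`, `le_of_parameter_choice`), and for this `k` the
expected residual is at most `ε / 2 + ε / 4`.
-/

namespace ZOEG

/-! ### The standard Gaussian law -/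

section Gaussian

variable {E : Type*} [NormedAddCommGroup E] [InnerProductSpace ℝ E] [FiniteDimensional ℝ E]
  [MeasurableSpace E] [BorelSpace E]

lemma integrable_exp_neg_mul_sq_norm {b : ℝ} (hb : 0 < b) :
    Integrable (fun u : E => Real.exp (-b * ‖u‖ ^ 2)) := by
  have h := (GaussianFourier.integrable_cexp_neg_mul_sq_norm_add (V := E) (b := (b : ℂ))
    (by simpa using hb) 0 0).norm
  refine h.congr (ae_of_all _ fun u => ?_)
  simp only [Complex.norm_exp, zero_mul, add_zero]
  congr 1
  rw [← Complex.ofReal_neg, ← Complex.ofReal_pow, ← Complex.ofReal_mul, Complex.ofReal_re]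

lemma integrable_exp_neg_sq_norm_div_two :
    Integrable (fun u : E => Real.exp (-‖u‖ ^ 2 / 2)) := by
  simp_rw [show ∀ u : E, -‖u‖ ^ 2 / 2 = -(1 / 2 : ℝ) * ‖u‖ ^ 2 from fun u => by ring]
  exact integrable_exp_neg_mul_sq_norm (by norm_num)

lemma integral_exp_neg_sq_norm_div_two :
    ∫ u : E, Real.exp (-‖u‖ ^ 2 / 2) = (2 * Real.pi) ^ (Module.finrank ℝ E / 2 : ℝ) := by
  simp_rw [show ∀ u : E, -‖u‖ ^ 2 / 2 = -(1 / 2 : ℝ) * ‖u‖ ^ 2 from fun u => by ring]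
  rw [GaussianFourier.integral_rexp_neg_mul_sq_norm (by norm_num)]
  congr 1; ring

lemma integral_exp_neg_sq_norm_div_two_pos :
    0 < ∫ u : E, Real.exp (-‖u‖ ^ 2 / 2) := by
  rw [integral_exp_neg_sq_norm_div_two]; positivity

/-- The density of the standard Gaussian law with respect to Lebesgue measure, obtained by
comparing characteristic functions. -/
lemma stdGaussian_eq_withDensity :
    stdGaussian E = (volume : Measure E).withDensity fun u =>
      ENNReal.ofReal ((∫ u : E, Real.exp (-‖u‖ ^ 2 / 2))⁻¹ * Real.exp (-‖u‖ ^ 2 / 2)) := by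
  set c : ℝ := (∫ u : E, Real.exp (-‖u‖ ^ 2 / 2))⁻¹ with hc
  have hcpos : 0 < c := inv_pos.2 integral_exp_neg_sq_norm_div_two_pos
  have hint : Integrable (fun u : E => c * Real.exp (-‖u‖ ^ 2 / 2)) :=
    integrable_exp_neg_sq_norm_div_two.const_mul c
  have : IsFiniteMeasure ((volume : Measure E).withDensity fun u =>
      ENNReal.ofReal (c * Real.exp (-‖u‖ ^ 2 / 2))) :=
    isFiniteMeasure_withDensity_ofReal hint.2
  refine Measure.ext_of_charFun (funext fun s => ?_)
  rw [charFun_stdGaussian, charFun_apply,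
    integral_withDensity_eq_integral_toReal_smul (by fun_prop) (by simp)]
  have h1 : ∀ u : E, (ENNReal.ofReal (c * Real.exp (-‖u‖ ^ 2 / 2))).toReal •
      Complex.exp (⟪u, s⟫_ℝ * Complex.I) =
      (c : ℂ) * Complex.exp (-(1 / 2 : ℂ) * ‖u‖ ^ 2 + Complex.I * ⟪s, u⟫_ℝ) := by
    intro u
    rw [ENNReal.toReal_ofReal (by positivity), Complex.real_smul, Complex.exp_add]
    push_cast
    rw [real_inner_comm, mul_assoc]
    congr 2
    · congr 1; ring
    · congr 1; ring
  simp_rw [h1]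
  rw [integral_const_mul, GaussianFourier.integral_cexp_neg_mul_sq_norm_add (by norm_num)]
  have h2 : ((Real.pi : ℂ) / (1 / 2 : ℂ)) ^ (Module.finrank ℝ E / 2 : ℂ)
      = ((c⁻¹ : ℝ) : ℂ) := by
    rw [hc, inv_inv, integral_exp_neg_sq_norm_div_two, Complex.ofReal_cpow (by positivity)]
    push_cast
    congr 1; ring
  rw [h2, ← mul_assoc, ← Complex.ofReal_mul, mul_inv_cancel₀ hcpos.ne', Complex.ofReal_one, one_mul]
  congr 1
  rw [Complex.I_sq]; ring

lemma integral_stdGaussian {F : Type*} [NormedAddCommGroup F] [NormedSpace ℝ F] (g : E → F) :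
    ∫ u, g u ∂(stdGaussian E) = (∫ u : E, Real.exp (-‖u‖ ^ 2 / 2))⁻¹ •
      ∫ u : E, Real.exp (-‖u‖ ^ 2 / 2) • g u := by
  have hpos := integral_exp_neg_sq_norm_div_two_pos (E := E)
  rw [stdGaussian_eq_withDensity,
    integral_withDensity_eq_integral_toReal_smul (by fun_prop) (by simp), ← integral_smul]
  refine integral_congr_ae (ae_of_all _ fun u => ?_)
  simp only
  rw [ENNReal.toReal_ofReal (by positivity), mul_smul]

lemma stdGaussian_absolutelyContinuous : stdGaussian E ≪ (volume : Measure E) := by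
  rw [stdGaussian_eq_withDensity]
  exact withDensity_absolutelyContinuous _ _

lemma absolutelyContinuous_stdGaussian : (volume : Measure E) ≪ stdGaussian E := by
  rw [stdGaussian_eq_withDensity]
  refine withDensity_absolutelyContinuous' (by fun_prop) (ae_of_all _ fun u => ?_)
  have hpos := integral_exp_neg_sq_norm_div_two_pos (E := E)
  simp only [ne_eq, ENNReal.ofReal_eq_zero, not_le]
  positivity

lemma integrable_exp_mul_norm_stdGaussian (a : ℝ) :
    Integrable (fun u : E => Real.exp (a * ‖u‖)) (stdGaussian E) := by
  obtain ⟨C, hC, hint⟩ := IsGaussian.exists_integrable_exp_sq (stdGaussian E)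
  refine (hint.const_mul (Real.exp (a ^ 2 / (4 * C)))).mono' (by fun_prop)
    (ae_of_all _ fun u => ?_)
  rw [Real.norm_of_nonneg (Real.exp_pos _).le, ← Real.exp_add]
  refine Real.exp_le_exp.2 ?_
  have : a ^ 2 / (4 * C) + C * ‖u‖ ^ 2 - a * ‖u‖ = (a - 2 * C * ‖u‖) ^ 2 / (4 * C) := by
    field_simp; ring
  have h2 : 0 ≤ (a - 2 * C * ‖u‖) ^ 2 / (4 * C) := by positivity
  linarith

lemma integrable_norm_pow_stdGaussian (k : ℕ) :
    Integrable (fun u : E => ‖u‖ ^ k) (stdGaussian E) := by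
  have := (IsGaussian.memLp_id (stdGaussian E) k (by simp)).integrable_norm_pow'
  simpa using this

lemma integral_sq_norm_stdGaussian :
    ∫ u, ‖u‖ ^ 2 ∂(stdGaussian E) = Module.finrank ℝ E := by
  let b := stdOrthonormalBasis ℝ E
  have h : ∀ u : E, ‖u‖ ^ 2 = ∑ i, (innerSL ℝ (b i) u) ^ 2 := by
    intro u
    rw [← b.sum_sq_norm_inner_right u]
    simp
  have h2 : ∀ i, ∫ u, (innerSL ℝ (b i) u) ^ 2 ∂(stdGaussian E) = 1 := by
    intro i
    have hv := variance_dual_stdGaussian (innerSL ℝ (b i))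
    rw [variance_of_integral_eq_zero (by fun_prop) (integral_strongDual_stdGaussian _)] at hv
    rw [hv]; simp
  simp_rw [h]
  rw [integral_finsetSum]
  · simp_rw [h2]; simp
  · intro i _
    exact ((IsGaussian.memLp_two_id (μ := stdGaussian E)).continuousLinearMap_comp
      (innerSL ℝ (b i))).integrable_sq

lemma integral_norm_stdGaussian_le :
    ∫ u, ‖u‖ ∂(stdGaussian E) ≤ √(Module.finrank ℝ E) := by
  refine Real.le_sqrt_of_sq_le ?_
  rw [← integral_sq_norm_stdGaussian]
  have h1 : MemLp (fun u : E => ‖u‖) 2 (stdGaussian E) := IsGaussian.memLp_two_id.norm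
  have := variance_nonneg (fun u : E => ‖u‖) (stdGaussian E)
  rw [variance_eq_sub h1] at this
  simpa using this

lemma integral_exp_sq_norm_div_four_stdGaussian :
    ∫ u, Real.exp (‖u‖ ^ 2 / 4) ∂(stdGaussian E) = 2 ^ (Module.finrank ℝ E / 2 : ℝ) := by
  rw [integral_stdGaussian, integral_exp_neg_sq_norm_div_two]
  have : ∀ u : E, Real.exp (-‖u‖ ^ 2 / 2) • Real.exp (‖u‖ ^ 2 / 4)
      = Real.exp (-(1 / 4 : ℝ) * ‖u‖ ^ 2) := by
    intro u
    rw [smul_eq_mul, ← Real.exp_add]; congr 1; ring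
  simp_rw [this]
  rw [GaussianFourier.integral_rexp_neg_mul_sq_norm (by norm_num), smul_eq_mul,
    ← Real.inv_rpow (by positivity), ← Real.mul_rpow (by positivity) (by positivity)]
  congr 1
  field_simp; norm_num

lemma integrable_exp_sq_norm_div_four_stdGaussian :
    Integrable (fun u : E => Real.exp (‖u‖ ^ 2 / 4)) (stdGaussian E) := by
  by_contra h
  have h2 := integral_exp_sq_norm_div_four_stdGaussian (E := E)
  rw [integral_undef h] at h2
  have : (0 : ℝ) < 2 ^ (Module.finrank ℝ E / 2 : ℝ) := by positivity
  linarith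

/-- Chernoff bound at the exponent `1/4`, in polynomial form:
`P(‖u‖ > R) ≤ 2^{d/2} e^{-R²/4} ≤ (4d / (e R²))^{d/2}`. -/
lemma stdGaussian_real_norm_gt_le (hd : 0 < Module.finrank ℝ E) {R : ℝ} (hR : 0 < R) :
    (stdGaussian E).real {u | R < ‖u‖} ≤
      (4 * Module.finrank ℝ E / (Real.exp 1 * R ^ 2)) ^ (Module.finrank ℝ E / 2 : ℝ) := by
  set d : ℝ := (Module.finrank ℝ E : ℝ) with hd'
  have hdpos : 0 < d := by rw [hd']; exact_mod_cast hd
  have h1 := mul_meas_ge_le_integral_of_nonneg (μ := stdGaussian E)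
    (ae_of_all _ fun u : E => (Real.exp_pos (‖u‖ ^ 2 / 4)).le)
    integrable_exp_sq_norm_div_four_stdGaussian (Real.exp (R ^ 2 / 4))
  rw [integral_exp_sq_norm_div_four_stdGaussian] at h1
  have h2 : (stdGaussian E).real {u | R < ‖u‖} ≤
      (stdGaussian E).real {u | Real.exp (R ^ 2 / 4) ≤ Real.exp (‖u‖ ^ 2 / 4)} := by
    refine measureReal_mono fun u hu => ?_
    have hu' : R < ‖u‖ := hu
    change Real.exp (R ^ 2 / 4) ≤ Real.exp (‖u‖ ^ 2 / 4)
    gcongr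
  -- `e^{-x} ≤ (a / (e x))^a` with `a = d/2` and `x = R²/4`
  have h3 : Real.exp (-(R ^ 2 / 4)) ≤ (2 * d / (Real.exp 1 * R ^ 2)) ^ (d / 2) := by
    have h4 : Real.exp (-(R ^ 2 / 4)) = (Real.exp (-(R ^ 2 / (2 * d)))) ^ (d / 2) := by
      rw [← Real.exp_mul]; congr 1; field_simp; norm_num
    rw [h4]
    refine Real.rpow_le_rpow (Real.exp_pos _).le ?_ (by positivity)
    have h5 := Real.add_one_le_exp (R ^ 2 / (2 * d) - 1)
    rw [Real.exp_sub, sub_add_cancel, le_div_iff₀ (Real.exp_pos _)] at h5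
    rw [Real.exp_neg, ← inv_div (Real.exp 1 * R ^ 2) (2 * d)]
    refine inv_anti₀ (by positivity) ?_
    calc _ = R ^ 2 / (2 * d) * Real.exp 1 := by ring
      _ ≤ _ := h5
  calc (stdGaussian E).real {u | R < ‖u‖} ≤ 2 ^ (d / 2) * Real.exp (-(R ^ 2 / 4)) := by
        refine h2.trans ?_
        rw [Real.exp_neg, ← div_eq_mul_inv, le_div_iff₀ (Real.exp_pos _), mul_comm]
        exact h1
    _ ≤ 2 ^ (d / 2) * (2 * d / (Real.exp 1 * R ^ 2)) ^ (d / 2) := by gcongr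
    _ = _ := by
        rw [← Real.mul_rpow (by positivity) (by positivity)]
        congr 1; ring

end Gaussian

/-! ### Gaussian smoothing of a Lipschitz function -/

section Smoothing

variable {n m : ℕ}

/-- `signFlip` as a linear isometry. -/
def signFlipₗᵢ : Z n m →ₗᵢ[ℝ] Z n m where
  toFun := signFlip
  map_add' v w := by
    ext i; cases i <;> simp [signFlip]; ring
  map_smul' c v := by
    ext i; cases i <;> simp [signFlip]
  norm_map' v := by
    simp [signFlip, EuclideanSpace.norm_eq]

lemma continuous_signFlip : Continuous (signFlip : Z n m → Z n m) :=
  signFlipₗᵢ.continuous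

lemma norm_signFlip (v : Z n m) : ‖signFlip v‖ = ‖v‖ := signFlipₗᵢ.norm_map v

lemma signFlip_sub (v w : Z n m) : signFlip v - signFlip w = signFlip (v - w) :=
  (map_sub signFlipₗᵢ v w).symm

lemma signFlip_smul (c : ℝ) (v : Z n m) : signFlip (c • v) = c • signFlip v :=
  map_smul signFlipₗᵢ c v

lemma finrank_Z : Module.finrank ℝ (Z n m) = n + m := by
  simp [Z]

lemma smoothed_eq_integral_stdGaussian (f : Z n m → ℝ) (μ : ℝ) (z : Z n m) :
    smoothed f μ z = ∫ u, f (z + μ • u) ∂(stdGaussian (Z n m)) := by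
  rw [integral_stdGaussian, smoothed, smul_eq_mul]
  simp [mul_comm]

variable {f : Z n m → ℝ} {C : NNReal}

lemma abs_sub_shift_le (hf : LipschitzWith C f) (μ : ℝ) (z u : Z n m) :
    |f (z + μ • u) - f z| ≤ C * |μ| * ‖u‖ := by
  have := hf.dist_le_mul (z + μ • u) z
  rw [Real.dist_eq, dist_eq_norm, add_sub_cancel_left, norm_smul, Real.norm_eq_abs] at this
  linarith

lemma abs_shift_le (hf : LipschitzWith C f) (μ : ℝ) (z u : Z n m) :
    |f (z + μ • u)| ≤ |f z| + C * |μ| * ‖u‖ := by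
  have h := abs_sub_shift_le hf μ z u
  have := abs_sub_abs_le_abs_sub (f (z + μ • u)) (f z)
  linarith

lemma integrable_norm_stdGaussian :
    Integrable (fun u : Z n m => ‖u‖) (stdGaussian (Z n m)) := by
  simpa using integrable_norm_pow_stdGaussian (E := Z n m) 1

lemma integrable_shift (hf : LipschitzWith C f) (μ : ℝ) (z : Z n m) :
    Integrable (fun u => f (z + μ • u)) (stdGaussian (Z n m)) := by
  refine ((integrable_const |f z|).add (integrable_norm_stdGaussian.const_mul (C * |μ|))).mono'
    ?_ (ae_of_all _ fun u => abs_shift_le hf μ z u)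
  exact (hf.continuous.comp (by fun_prop)).aestronglyMeasurable

/-- Rademacher's theorem, transported along `u ↦ z + μ u` to the standard Gaussian law. -/
lemma ae_differentiableAt_shift (hf : LipschitzWith C f) {μ : ℝ} (hμ : μ ≠ 0) (z : Z n m) :
    ∀ᵐ u ∂(stdGaussian (Z n m)), DifferentiableAt ℝ f (z + μ • u) := by
  have hg : LipschitzWith (C * (0 + ‖μ‖₊ * 1)) fun u : Z n m => f (z + μ • u) :=
    hf.comp ((LipschitzWith.const z).add ((lipschitzWith_smul μ).comp LipschitzWith.id))
  refine stdGaussian_absolutelyContinuous.ae_le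
    ((hg.ae_differentiableAt (μ := volume)).mono fun u hu => ?_)
  have h1 : f = (fun u => f (z + μ • u)) ∘ fun w => μ⁻¹ • (w - z) := by
    ext w; simp [smul_smul, hμ]
  rw [h1]
  refine DifferentiableAt.comp _ ?_ (by fun_prop)
  simpa [smul_smul, hμ] using hu

/-- Differentiation under the integral sign: the derivative of the smoothing is the smoothing of
the (almost everywhere defined) derivative. -/
lemma hasFDerivAt_smoothed (hf : LipschitzWith C f) {μ : ℝ} (hμ : μ ≠ 0) (z : Z n m) :
    Integrable (fun u => fderiv ℝ f (z + μ • u)) (stdGaussian (Z n m)) ∧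
      HasFDerivAt (smoothed f μ) (∫ u, fderiv ℝ f (z + μ • u) ∂(stdGaussian (Z n m))) z := by
  have h0 : smoothed f μ = fun z => ∫ u, f (z + μ • u) ∂(stdGaussian (Z n m)) :=
    funext fun z => smoothed_eq_integral_stdGaussian f μ z
  rw [h0]
  refine hasFDerivAt_integral_of_dominated_loc_of_lip (bound := fun _ => (C : ℝ))
    (F := fun z u => f (z + μ • u)) (s := Set.univ) univ_mem
    (Eventually.of_forall fun x => (integrable_shift hf μ x).aestronglyMeasurable)
    (integrable_shift hf μ z) ?_ (ae_of_all _ fun u => ?_) (integrable_const _) ?_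
  · exact ((measurable_fderiv ℝ f).comp (by fun_prop)).aestronglyMeasurable
  · refine LipschitzWith.lipschitzOnWith ?_
    have h : LipschitzWith (C * (1 + 0)) fun x : Z n m => f (x + μ • u) :=
      hf.comp (LipschitzWith.id.add (LipschitzWith.const _))
    simpa using h
  · filter_upwards [ae_differentiableAt_shift hf hμ z] with u hu
    exact (hasFDerivAt_comp_add_right (μ • u)).2 hu.hasFDerivAt

lemma differentiable_smoothed (hf : LipschitzWith C f) {μ : ℝ} (hμ : μ ≠ 0) :
    Differentiable ℝ (smoothed f μ) :=
  fun z => (hasFDerivAt_smoothed hf hμ z).2.differentiableAt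

lemma integrable_gradient_shift (hf : LipschitzWith C f) {μ : ℝ} (hμ : μ ≠ 0) (z : Z n m) :
    Integrable (fun u => ∇ f (z + μ • u)) (stdGaussian (Z n m)) :=
  (InnerProductSpace.toDual ℝ (Z n m)).symm.toContinuousLinearEquiv.toContinuousLinearMap
    |>.integrable_comp (hasFDerivAt_smoothed hf hμ z).1

lemma gradient_smoothed_eq_integral_gradient (hf : LipschitzWith C f) {μ : ℝ} (hμ : μ ≠ 0)
    (z : Z n m) :
    ∇ (smoothed f μ) z = ∫ u, ∇ f (z + μ • u) ∂(stdGaussian (Z n m)) := by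
  rw [gradient, (hasFDerivAt_smoothed hf hμ z).2.fderiv]
  exact ((InnerProductSpace.toDual ℝ (Z n m)).symm.toContinuousLinearEquiv.toContinuousLinearMap
    |>.integral_comp_comm (hasFDerivAt_smoothed hf hμ z).1).symm

/-- The Cameron–Martin shift: translating the argument of the smoothing by `s μ v` is the same as
reweighting the Gaussian law by `exp (s⟪u, v⟫ - s²‖v‖²/2)`. -/
lemma smoothed_add_smul (f : Z n m → ℝ) (μ : ℝ) (z v : Z n m) (s : ℝ) :
    smoothed f μ (z + s • μ • v) = ∫ u, f (z + μ • u) *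
      Real.exp (s * ⟪u, v⟫_ℝ - s ^ 2 * ‖v‖ ^ 2 / 2) ∂(stdGaussian (Z n m)) := by
  rw [smoothed_eq_integral_stdGaussian, integral_stdGaussian, integral_stdGaussian]
  congr 1
  refine (integral_sub_right_eq_self _ (s • v)).symm.trans ?_
  refine integral_congr_ae (ae_of_all _ fun u => ?_)
  simp only [smul_eq_mul]
  have h1 : z + s • μ • v + μ • (u - s • v) = z + μ • u := by
    rw [smul_sub, smul_comm μ s v]; abel
  have h2 : -‖u - s • v‖ ^ 2 / 2 = -‖u‖ ^ 2 / 2 + (s * ⟪u, v⟫_ℝ - s ^ 2 * ‖v‖ ^ 2 / 2) := by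
    rw [norm_sub_sq_real, real_inner_smul_right, norm_smul, mul_pow, Real.norm_eq_abs, sq_abs]
    ring
  rw [h1, h2, Real.exp_add]
  ring

/-- Gaussian integration by parts for a Lipschitz function, obtained by differentiating the
Cameron–Martin shift at `s = 0`. -/
lemma mul_inner_gradient_smoothed (hf : LipschitzWith C f) {μ : ℝ} (hμ : μ ≠ 0) (z v : Z n m) :
    μ * ⟪∇ (smoothed f μ) z, v⟫_ℝ =
      ∫ u, f (z + μ • u) * ⟪u, v⟫_ℝ ∂(stdGaussian (Z n m)) := by
  have h1 : HasDerivAt (fun s : ℝ => smoothed f μ (z + s • μ • v))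
      (μ * ⟪∇ (smoothed f μ) z, v⟫_ℝ) 0 := by
    have hg := (differentiable_smoothed hf hμ z).hasGradientAt.hasFDerivAt
    have hl : HasDerivAt (fun s : ℝ => z + s • μ • v) (μ • v) 0 := by
      simpa using ((hasDerivAt_id (0 : ℝ)).smul_const (μ • v)).const_add z
    have hg' : HasFDerivAt (smoothed f μ)
        (InnerProductSpace.toDual ℝ (Z n m) (∇ (smoothed f μ) z)) (z + (0 : ℝ) • μ • v) := by
      simpa using hg
    have := hg'.comp_hasDerivAt (0 : ℝ) hl
    simpa [real_inner_smul_right, Function.comp_def] using this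
  simp_rw [smoothed_add_smul] at h1
  set e : ℝ → Z n m → ℝ := fun s u => Real.exp (s * ⟪u, v⟫_ℝ - s ^ 2 * ‖v‖ ^ 2 / 2) with he
  have hcont : ∀ μ : ℝ, Continuous fun u => f (z + μ • u) := fun μ =>
    hf.continuous.comp (by fun_prop)
  have hinner : ∀ u : Z n m, |⟪u, v⟫_ℝ| ≤ ‖u‖ * ‖v‖ := fun u => abs_real_inner_le_norm u v
  have hexp : ∀ u : Z n m, ‖u‖ ≤ Real.exp ‖u‖ ∧ 1 ≤ Real.exp ‖u‖ := fun u =>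
    ⟨by linarith [Real.add_one_le_exp ‖u‖], Real.one_le_exp (norm_nonneg u)⟩
  have hM : ∀ u, |f (z + μ • u)| ≤ (|f z| + C * |μ|) * Real.exp ‖u‖ := fun u => by
    refine (abs_shift_le hf μ z u).trans ?_
    rw [add_mul]
    gcongr
    · exact le_mul_of_one_le_right (abs_nonneg _) (hexp u).2
    · exact (hexp u).1
  have h2 := hasDerivAt_integral_of_dominated_loc_of_deriv_le (x₀ := (0 : ℝ))
    (F := fun s u => f (z + μ • u) * e s u)
    (F' := fun s u => f (z + μ • u) * (e s u * (⟪u, v⟫_ℝ - s * ‖v‖ ^ 2)))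
    (bound := fun u => (|f z| + C * |μ|) * (‖v‖ + ‖v‖ ^ 2) * Real.exp ((‖v‖ + 2) * ‖u‖))
    (μ := stdGaussian (Z n m)) (s := Metric.ball 0 1) (Metric.ball_mem_nhds 0 one_pos)
    (Eventually.of_forall fun s =>
      ((hcont μ).mul (by rw [he]; fun_prop)).aestronglyMeasurable)
    (by simpa [he] using integrable_shift hf μ z)
    ((hcont μ).mul (by rw [he]; fun_prop)).aestronglyMeasurable
    (ae_of_all _ fun u s hs => ?_)
    ((integrable_exp_mul_norm_stdGaussian _).const_mul _)
    (ae_of_all _ fun u s hs => ?_)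
  · rw [h1.unique h2.2]
    simp [he]
  · have hs' : |s| ≤ 1 := by
      have : |s| < 1 := by simpa using hs
      exact this.le
    have he1 : e s u ≤ Real.exp (‖v‖ * ‖u‖) := by
      refine Real.exp_le_exp.2 ?_
      have : s * ⟪u, v⟫_ℝ ≤ 1 * (‖u‖ * ‖v‖) := by
        refine (le_abs_self _).trans ?_
        rw [abs_mul]
        exact mul_le_mul hs' (hinner u) (abs_nonneg _) zero_le_one
      have h0 : 0 ≤ s ^ 2 * ‖v‖ ^ 2 / 2 := by positivity
      linarith
    have he2 : |⟪u, v⟫_ℝ - s * ‖v‖ ^ 2| ≤ (‖v‖ + ‖v‖ ^ 2) * Real.exp ‖u‖ := by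
      refine (abs_sub _ _).trans ?_
      rw [add_mul, abs_mul, abs_of_nonneg (sq_nonneg ‖v‖)]
      refine add_le_add ((hinner u).trans ?_) ?_
      · rw [mul_comm]
        exact mul_le_mul_of_nonneg_left (hexp u).1 (norm_nonneg v)
      · rw [mul_comm]
        exact mul_le_mul_of_nonneg_left (hs'.trans (hexp u).2) (sq_nonneg _)
    rw [norm_mul, norm_mul, Real.norm_eq_abs, Real.norm_eq_abs, Real.norm_eq_abs,
      abs_of_pos (Real.exp_pos _ : 0 < e s u)]
    calc |f (z + μ • u)| * (e s u * |⟪u, v⟫_ℝ - s * ‖v‖ ^ 2|)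
        ≤ ((|f z| + C * |μ|) * Real.exp ‖u‖) *
          (Real.exp (‖v‖ * ‖u‖) * ((‖v‖ + ‖v‖ ^ 2) * Real.exp ‖u‖)) := by
          have := hM u
          have : 0 ≤ e s u := (Real.exp_pos _).le
          gcongr
      _ = (|f z| + C * |μ|) * (‖v‖ + ‖v‖ ^ 2) *
          (Real.exp ‖u‖ * Real.exp (‖v‖ * ‖u‖) * Real.exp ‖u‖) := by ring
      _ = _ := by
          rw [← Real.exp_add, ← Real.exp_add]
          congr 2; ring
  · refine HasDerivAt.const_mul _ ?_
    have hlin : HasDerivAt (fun s : ℝ => s * ⟪u, v⟫_ℝ - s ^ 2 * ‖v‖ ^ 2 / 2)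
        (⟪u, v⟫_ℝ - s * ‖v‖ ^ 2) s := by
      have ha : HasDerivAt (fun s : ℝ => s * ⟪u, v⟫_ℝ) ⟪u, v⟫_ℝ s := by
        simpa using (hasDerivAt_id s).mul_const ⟪u, v⟫_ℝ
      have hb : HasDerivAt (fun s : ℝ => s ^ 2 * ‖v‖ ^ 2 / 2) (2 * s * ‖v‖ ^ 2 / 2) s := by
        simpa using ((hasDerivAt_pow 2 s).mul_const (‖v‖ ^ 2)).div_const 2
      exact (ha.sub hb).congr_deriv (by ring)
    exact hlin.exp

lemma integrable_shift_smul (hf : LipschitzWith C f) (μ : ℝ) (z : Z n m) :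
    Integrable (fun u => f (z + μ • u) • u) (stdGaussian (Z n m)) := by
  refine ((integrable_norm_stdGaussian.const_mul |f z|).add
    ((integrable_norm_pow_stdGaussian 2).const_mul (C * |μ|))).mono'
    ((hf.continuous.comp (by fun_prop)).smul continuous_id).aestronglyMeasurable
    (ae_of_all _ fun u => ?_)
  rw [norm_smul, Real.norm_eq_abs]
  have := mul_le_mul_of_nonneg_right (abs_shift_le hf μ z u) (norm_nonneg u)
  refine this.trans_eq ?_
  simp only [Pi.add_apply]
  ring

lemma smul_gradient_smoothed (hf : LipschitzWith C f) {μ : ℝ} (hμ : μ ≠ 0) (z : Z n m) :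
    μ • ∇ (smoothed f μ) z = ∫ u, f (z + μ • u) • u ∂(stdGaussian (Z n m)) := by
  refine ext_inner_left ℝ fun v => ?_
  rw [← integral_inner (integrable_shift_smul hf μ z), real_inner_smul_right, real_inner_comm,
    mul_inner_gradient_smoothed hf hμ]
  simp_rw [real_inner_smul_right, real_inner_comm v]

/-- The gradient of the smoothing is Lipschitz: by the integration by parts formula its increments
are at most `μ⁻¹ E[|f(z + μu) - f(w + μu)| ‖u‖]`, and `E‖u‖ ≤ √d`. -/
lemma norm_gradient_smoothed_sub_le (hf : LipschitzWith C f) {μ : ℝ} (hμ : 0 < μ) (z w : Z n m) :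
    ‖∇ (smoothed f μ) z - ∇ (smoothed f μ) w‖ ≤ √(n + m : ℕ) / μ * C * ‖z - w‖ := by
  have h1 : μ • (∇ (smoothed f μ) z - ∇ (smoothed f μ) w) =
      ∫ u, (f (z + μ • u) - f (w + μ • u)) • u ∂(stdGaussian (Z n m)) := by
    rw [smul_sub, smul_gradient_smoothed hf hμ.ne', smul_gradient_smoothed hf hμ.ne',
      ← integral_sub (integrable_shift_smul hf μ z) (integrable_shift_smul hf μ w)]
    simp_rw [sub_smul]
  have h2 : ‖μ • (∇ (smoothed f μ) z - ∇ (smoothed f μ) w)‖ ≤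
      ∫ u, C * ‖z - w‖ * ‖u‖ ∂(stdGaussian (Z n m)) := by
    rw [h1]
    refine norm_integral_le_of_norm_le (integrable_norm_stdGaussian.const_mul _)
      (ae_of_all _ fun u => ?_)
    rw [norm_smul]
    refine mul_le_mul_of_nonneg_right ?_ (norm_nonneg u)
    have := hf.dist_le_mul (z + μ • u) (w + μ • u)
    rwa [dist_eq_norm, dist_eq_norm, add_sub_add_right_eq_sub] at this
  rw [integral_const_mul, norm_smul, Real.norm_of_nonneg hμ.le] at h2
  have h3 := integral_norm_stdGaussian_le (E := Z n m)
  rw [finrank_Z] at h3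
  have h4 : C * ‖z - w‖ * ∫ u, ‖u‖ ∂(stdGaussian (Z n m)) ≤ C * ‖z - w‖ * √(n + m : ℕ) := by
    gcongr
  rw [div_mul_eq_mul_div, div_mul_eq_mul_div, le_div_iff₀ hμ]
  linarith

lemma norm_gradient_le (hf : LipschitzWith C f) (z : Z n m) : ‖∇ f z‖ ≤ C := by
  rw [gradient, LinearIsometryEquiv.norm_map]
  exact norm_fderiv_le_of_lipschitz ℝ hf

lemma norm_gradient_smoothed_le (hf : LipschitzWith C f) {μ : ℝ} (hμ : μ ≠ 0) (z : Z n m) :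
    ‖∇ (smoothed f μ) z‖ ≤ C := by
  rw [gradient_smoothed_eq_integral_gradient hf hμ]
  simpa using norm_integral_le_of_norm_le_const (μ := stdGaussian (Z n m))
    (ae_of_all _ fun u => norm_gradient_le hf (z + μ • u))

/-! ### The zeroth-order oracle -/

lemma continuous_oracle (hf : LipschitzWith C f) (μ : ℝ) :
    Continuous fun p : Z n m × Z n m => oracle f μ p.1 p.2 := by
  have h1 : Continuous fun p : Z n m × Z n m => f (p.1 + μ • p.2) :=
    hf.continuous.comp (by fun_prop)
  have h2 : Continuous fun p : Z n m × Z n m => f p.1 := hf.continuous.comp (by fun_prop)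
  exact ((h1.sub h2).div_const μ).smul (continuous_signFlip.comp continuous_snd)

lemma norm_oracle_le (hf : LipschitzWith C f) {μ : ℝ} (hμ : 0 < μ) (z u : Z n m) :
    ‖oracle f μ z u‖ ≤ C * ‖u‖ ^ 2 := by
  rw [oracle, norm_smul, norm_signFlip, Real.norm_eq_abs, abs_div, abs_of_pos hμ, sq, ← mul_assoc]
  refine mul_le_mul_of_nonneg_right ?_ (norm_nonneg u)
  rw [div_le_iff₀ hμ]
  have := abs_sub_shift_le hf μ z u
  rw [abs_of_pos hμ] at this
  linarith

lemma memLp_mul_sq_norm_stdGaussian (c : ℝ) :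
    MemLp (fun u : Z n m => c * ‖u‖ ^ 2) 2 (stdGaussian (Z n m)) := by
  refine MemLp.const_mul (f := fun u : Z n m => ‖u‖ ^ 2) ?_ c
  rw [memLp_two_iff_integrable_sq (by fun_prop)]
  simp_rw [← pow_mul]
  exact integrable_norm_pow_stdGaussian _

lemma memLp_oracle (hf : LipschitzWith C f) {μ : ℝ} (hμ : 0 < μ) (z : Z n m) :
    MemLp (oracle f μ z) 2 (stdGaussian (Z n m)) := by
  have hc : Continuous (oracle f μ z) :=
    (continuous_oracle hf μ).comp (by fun_prop : Continuous fun u : Z n m => (z, u))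
  refine MemLp.mono' (g := fun u => C * ‖u‖ ^ 2) ?_ hc.aestronglyMeasurable
    (ae_of_all _ fun u => norm_oracle_le hf hμ z u)
  exact memLp_mul_sq_norm_stdGaussian C

/-- The oracle is an unbiased estimator of `F_μ(z)`. -/
lemma integral_oracle (hf : LipschitzWith C f) {μ : ℝ} (hμ : 0 < μ) (z : Z n m) :
    ∫ u, oracle f μ z u ∂(stdGaussian (Z n m)) = smoothedOperator f μ z := by
  have h1 : ∀ u, oracle f μ z u =
      signFlipₗᵢ.toContinuousLinearMap (μ⁻¹ • (f (z + μ • u) • u - f z • u)) := by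
    intro u
    rw [← sub_smul, smul_smul]
    change _ = signFlip _
    rw [signFlip_smul, oracle, div_eq_inv_mul]
  have h2 : Integrable (fun u : Z n m => f z • u) (stdGaussian (Z n m)) :=
    Integrable.smul (f z) IsGaussian.integrable_fun_id
  simp_rw [h1]
  have h3 : Integrable (fun u => μ⁻¹ • (f (z + μ • u) • u - f z • u)) (stdGaussian (Z n m)) :=
    ((integrable_shift_smul hf μ z).sub h2).smul μ⁻¹
  rw [ContinuousLinearMap.integral_comp_comm _ h3, integral_smul,
    integral_sub (integrable_shift_smul hf μ z) h2, ← smul_gradient_smoothed hf hμ.ne',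
    integral_smul, integral_id_stdGaussian, smul_zero, sub_zero, smul_smul,
    inv_mul_cancel₀ hμ.ne', one_smul]
  rfl

lemma integral_oracle_sub (hf : LipschitzWith C f) {μ : ℝ} (hμ : 0 < μ) (z : Z n m) :
    ∫ u, (oracle f μ z u - smoothedOperator f μ z) ∂(stdGaussian (Z n m)) = 0 := by
  rw [integral_sub ((memLp_oracle hf hμ z).integrable one_le_two) (integrable_const _),
    integral_oracle hf hμ]
  simp

lemma norm_smoothedOperator (f : Z n m → ℝ) (μ : ℝ) (z : Z n m) :
    ‖smoothedOperator f μ z‖ = ‖∇ (smoothed f μ) z‖ := norm_signFlip _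

end Smoothing

/-! ### Clarke and Goldstein subdifferentials -/

section Clarke

variable {n m : ℕ} {f : Z n m → ℝ} {C : NNReal}

lemma abs_diffQuotient_le (hf : LipschitzWith C f) (z v : Z n m) {t : ℝ} (ht : 0 < t) :
    |(f (z + t • v) - f z) / t| ≤ C * ‖v‖ := by
  rw [abs_div, abs_of_pos ht, div_le_iff₀ ht]
  have := abs_sub_shift_le hf t z v
  rw [abs_of_pos ht] at this
  linarith

lemma eventually_abs_diffQuotient_le (hf : LipschitzWith C f) (z v : Z n m) :
    ∀ᶠ p : Z n m × ℝ in 𝓝 z ×ˢ 𝓝[>] (0 : ℝ),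
      |(f (p.1 + p.2 • v) - f p.1) / p.2| ≤ C * ‖v‖ :=
  (tendsto_snd.eventually (eventually_mem_nhdsWithin : ∀ᶠ t in 𝓝[>] (0 : ℝ), t ∈ Set.Ioi 0)).mono
    fun p hp => abs_diffQuotient_le hf p.1 v hp

lemma isBoundedUnder_le_diffQuotient (hf : LipschitzWith C f) (z v : Z n m) :
    IsBoundedUnder (· ≤ ·) (𝓝 z ×ˢ 𝓝[>] (0 : ℝ))
      fun p : Z n m × ℝ => (f (p.1 + p.2 • v) - f p.1) / p.2 :=
  isBoundedUnder_of_eventually_le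
    ((eventually_abs_diffQuotient_le hf z v).mono fun _ hp => (abs_le.1 hp).2)

lemma isCoboundedUnder_le_diffQuotient (hf : LipschitzWith C f) (z v : Z n m) :
    IsCoboundedUnder (· ≤ ·) (𝓝 z ×ˢ 𝓝[>] (0 : ℝ))
      fun p : Z n m × ℝ => (f (p.1 + p.2 • v) - f p.1) / p.2 :=
  (isBoundedUnder_of_eventually_ge
    ((eventually_abs_diffQuotient_le hf z v).mono fun _ hp => (abs_le.1 hp).1)).isCoboundedUnder_le

lemma clarkeDeriv_le (hf : LipschitzWith C f) (z v : Z n m) : clarkeDeriv f z v ≤ C * ‖v‖ :=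
  limsup_le_of_le (isCoboundedUnder_le_diffQuotient hf z v)
    ((eventually_abs_diffQuotient_le hf z v).mono fun _ hp => (abs_le.1 hp).2)

/-- `z ↦ f°(z; v)` is upper semicontinuous. -/
lemma eventually_clarkeDeriv_le (hf : LipschitzWith C f) {z v : Z n m} {c : ℝ}
    (h : clarkeDeriv f z v < c) : ∀ᶠ z' in 𝓝 z, clarkeDeriv f z' v ≤ c := by
  have h1 := eventually_lt_of_limsup_lt h (isBoundedUnder_le_diffQuotient hf z v)
  obtain ⟨pa, ha, pb, hb, hab⟩ := eventually_prod_iff.1 h1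
  filter_upwards [eventually_eventually_nhds.2 ha] with z' hz'
  refine limsup_le_of_le (isCoboundedUnder_le_diffQuotient hf z' v) ?_
  exact eventually_prod_iff.2 ⟨pa, hz', pb, hb, fun hx _ hy => (hab hx hy).le⟩

lemma norm_le_of_mem_generalisedGradient (hf : LipschitzWith C f) {z g : Z n m}
    (hg : g ∈ generalisedGradient f z) : ‖g‖ ≤ C := by
  have h := (hg g).trans (clarkeDeriv_le hf z g)
  rw [real_inner_self_eq_norm_sq, sq] at h
  by_contra! hlt
  have : 0 < ‖g‖ := C.2.trans_lt hlt
  nlinarith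

lemma gradient_mem_generalisedGradient (hf : LipschitzWith C f) {z : Z n m}
    (hz : DifferentiableAt ℝ f z) : ∇ f z ∈ generalisedGradient f z := by
  intro v
  have h1 : Tendsto (fun t : ℝ => (f (z + t • v) - f z) / t) (𝓝[>] 0) (𝓝 ⟪∇ f z, v⟫_ℝ) := by
    have h := (hz.hasGradientAt.hasFDerivAt.hasLineDerivAt v).tendsto_slope_zero_right
    simpa [div_eq_inv_mul] using h
  refine le_of_forall_gt fun c hc => ?_
  obtain ⟨c', hc', hc'c⟩ := exists_between hc
  refine lt_of_le_of_lt ?_ hc'c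
  have h2 := eventually_lt_of_limsup_lt hc' (isBoundedUnder_le_diffQuotient hf z v)
  have h3 : Tendsto (fun t : ℝ => (z, t)) (𝓝[>] 0) (𝓝 z ×ˢ 𝓝[>] (0 : ℝ)) :=
    tendsto_const_nhds.prodMk tendsto_id
  exact le_of_tendsto h1 ((h3.eventually h2).mono fun t ht => ht.le)

/-- The graph of the generalised gradient is closed. -/
lemma isClosed_graph_generalisedGradient (hf : LipschitzWith C f) :
    IsClosed {p : Z n m × Z n m | p.2 ∈ generalisedGradient f p.1} := by
  have h : {p : Z n m × Z n m | p.2 ∈ generalisedGradient f p.1} =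
      ⋂ v, {p | ⟪p.2, v⟫_ℝ ≤ clarkeDeriv f p.1 v} := by
    ext p; simp [generalisedGradient]
  rw [h]
  refine isClosed_iInter fun v => ?_
  have hopen : IsOpen {p : Z n m × Z n m | clarkeDeriv f p.1 v < ⟪p.2, v⟫_ℝ} := by
    rw [isOpen_iff_mem_nhds]
    intro p hp
    obtain ⟨c, hc1, hc2⟩ := exists_between (show clarkeDeriv f p.1 v < ⟪p.2, v⟫_ℝ from hp)
    have h1 : ∀ᶠ q : Z n m × Z n m in 𝓝 p, clarkeDeriv f q.1 v ≤ c :=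
      continuousAt_fst.eventually (eventually_clarkeDeriv_le hf hc1)
    have h2 : ∀ᶠ q : Z n m × Z n m in 𝓝 p, c < ⟪q.2, v⟫_ℝ :=
      (continuous_snd.inner continuous_const).continuousAt.eventually (lt_mem_nhds hc2)
    filter_upwards [h1, h2] with q hq1 hq2 using hq1.trans_lt hq2
  simpa only [Set.compl_ofPred, not_lt] using hopen.isClosed_compl

/-- If the generalised gradients at `z` lie in an open half-space, then so do those at all nearby
points. -/
lemma isOpen_generalisedGradient_inner_gt (hf : LipschitzWith C f) (p : Z n m) (κ : ℝ) :
    IsOpen {z | ∀ g ∈ generalisedGradient f z, κ < ⟪g, p⟫_ℝ} := by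
  rw [isOpen_iff_mem_nhds]
  intro z hz
  have h := (isCompact_closedBall (0 : Z n m) C).eventually_forall_of_forall_eventually
    (x₀ := z) (P := fun z' g => g ∈ generalisedGradient f z' → κ < ⟪g, p⟫_ℝ) ?_
  · filter_upwards [h] with z' hz' g hg
    exact hz' g (by simpa using norm_le_of_mem_generalisedGradient hf hg) hg
  · intro g _
    by_cases hg : g ∈ generalisedGradient f z
    · have h2 : ∀ᶠ q : Z n m × Z n m in 𝓝 (z, g), κ < ⟪q.2, p⟫_ℝ :=
        (by fun_prop : Continuous fun q : Z n m × Z n m => ⟪q.2, p⟫_ℝ).continuousAt.eventually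
          (lt_mem_nhds (hz g hg))
      exact h2.mono fun q hq _ => hq
    · have h2 := (isClosed_graph_generalisedGradient hf).isOpen_compl.mem_nhds
        (show (z, g) ∈ {p : Z n m × Z n m | p.2 ∈ generalisedGradient f p.1}ᶜ from hg)
      filter_upwards [h2] with q hq hq'
      exact absurd hq' hq

lemma goldsteinSubdifferential_nonempty (hf : LipschitzWith C f) {δ : ℝ} (hδ : 0 < δ) (z : Z n m) :
    (goldsteinSubdifferential f δ z).Nonempty := by
  obtain ⟨w, hw, hd⟩ := (Measure.dense_of_ae
    (hf.ae_differentiableAt (μ := (volume : Measure (Z n m))))).exists_dist_lt z hδ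
  exact ⟨∇ f w, subset_convexHull ℝ _ (Set.mem_iUnion₂.2
    ⟨w, by rw [Metric.mem_closedBall']; exact hd.le, gradient_mem_generalisedGradient hf hw⟩)⟩

lemma goldsteinResidual_le_of_mem_closure {δ : ℝ} {z a : Z n m}
    (ha : a ∈ closure (goldsteinSubdifferential f δ z)) : goldsteinResidual f δ z ≤ ‖a‖ₑ := by
  have hcl : IsClosed {g : Z n m | goldsteinResidual f δ z ≤ ‖g‖ₑ} :=
    isClosed_le continuous_const continuous_enorm
  exact closure_minimal (fun g hg => (iInf₂_le g hg : goldsteinResidual f δ z ≤ ‖g‖ₑ)) hcl ha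

/-- The distance from `0` to the Goldstein subdifferential is lower semicontinuous: if it exceeds
`c` at `z`, then `∂_δ f(z)` is strictly separated from the closed ball of radius `c` by the
hyperplane orthogonal to its element of minimal norm, and by compactness of the ball
`‖z' - z‖ ≤ δ` the same hyperplane works at all nearby points. -/
lemma lowerSemicontinuous_goldsteinResidual (hf : LipschitzWith C f) {δ : ℝ} (hδ : 0 < δ) :
    LowerSemicontinuous (goldsteinResidual f δ) := by
  intro z a ha
  set K := closure (goldsteinSubdifferential f δ z) with hK
  have hKc : Convex ℝ K := (convex_convexHull ℝ _).closure
  obtain ⟨p, hpK, hp⟩ := exists_norm_eq_iInf_of_complete_convex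
    (goldsteinSubdifferential_nonempty hf hδ z).closure isClosed_closure.isComplete hKc 0
  rw [norm_eq_iInf_iff_real_inner_le_zero hKc hpK] at hp
  have hp' : ∀ w ∈ K, ‖p‖ ^ 2 ≤ ⟪w, p⟫_ℝ := by
    intro w hw
    have := hp w hw
    rw [zero_sub, inner_neg_left, inner_sub_right, real_inner_self_eq_norm_sq,
      real_inner_comm] at this
    linarith
  have hap : a < ‖p‖ₑ := ha.trans_le (goldsteinResidual_le_of_mem_closure hpK)
  have hatop : a ≠ ∞ := hap.ne_top
  set c := a.toReal with hc
  have hac : a = ENNReal.ofReal c := (ENNReal.ofReal_toReal hatop).symm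
  have hc0 : 0 ≤ c := ENNReal.toReal_nonneg
  have hcp : c < ‖p‖ := by
    rw [hac, ← ofReal_norm] at hap
    exact (ENNReal.ofReal_lt_ofReal_iff_of_nonneg hc0).1 hap
  have hp0 : 0 < ‖p‖ := hc0.trans_lt hcp
  set κ := (c + ‖p‖) / 2 * ‖p‖ with hκ
  set U := {z | ∀ g ∈ generalisedGradient f z, κ < ⟪g, p⟫_ℝ} with hU
  have hball : Metric.closedBall z δ ⊆ U := by
    intro w hw g hg
    have : g ∈ K := subset_closure (subset_convexHull ℝ _ (Set.mem_iUnion₂.2 ⟨w, hw, hg⟩))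
    refine lt_of_lt_of_le ?_ (hp' g this)
    rw [hκ, sq]
    exact mul_lt_mul_of_pos_right (by linarith) hp0
  obtain ⟨η, hη, hηU⟩ := (isCompact_closedBall z δ).exists_thickening_subset_open
    (isOpen_generalisedGradient_inner_gt hf p κ) hball
  filter_upwards [Metric.ball_mem_nhds z hη] with z' hz'
  have hsub : goldsteinSubdifferential f δ z' ⊆ {g | κ < ⟪g, p⟫_ℝ} := by
    refine convexHull_min (Set.iUnion₂_subset fun w hw g hg => ?_) ?_
    · refine hηU (Metric.mem_thickening_iff.2 ⟨w - z' + z, ?_, ?_⟩) g hg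
      · simpa [dist_eq_norm] using hw
      · rw [Metric.mem_ball, dist_eq_norm] at hz'
        rw [dist_eq_norm]
        convert hz' using 2
        abel
    · have hlin : IsLinearMap ℝ fun g : Z n m => ⟪g, p⟫_ℝ :=
        ⟨fun x y => inner_add_left x y p, fun r x => real_inner_smul_left x p r⟩
      exact convex_halfSpace_gt hlin κ
  have hlt : a < ENNReal.ofReal ((c + ‖p‖) / 2) := by
    rw [hac]
    exact (ENNReal.ofReal_lt_ofReal_iff (by linarith)).2 (by linarith)
  refine hlt.trans_le (le_iInf₂ fun g hg => ?_)
  rw [← ofReal_norm]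
  refine ENNReal.ofReal_le_ofReal ?_
  have h1 : κ < ⟪g, p⟫_ℝ := hsub hg
  have h2 := h1.le.trans (real_inner_le_norm g p)
  exact le_of_mul_le_mul_right h2 hp0

/-- The average of `∇f` over the ball of radius `δ` lies in the closure of `∂_δ f(z)` and differs
from the Gaussian average `∇f_μ(z)` only through the Gaussian mass outside this ball. -/
lemma exists_mem_closure_goldsteinSubdifferential (hf : LipschitzWith C f) {μ δ : ℝ} (hμ : 0 < μ)
    (hδ : 0 < δ) (z : Z n m) :
    ∃ a ∈ closure (goldsteinSubdifferential f δ z), ‖∇ (smoothed f μ) z - a‖ ≤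
      2 * C * (stdGaussian (Z n m)).real {u | δ / μ < ‖u‖} := by
  set γ := stdGaussian (Z n m)
  set B : Set (Z n m) := Metric.closedBall 0 (δ / μ) with hB
  have hBm : MeasurableSet B := Metric.isClosed_closedBall.measurableSet
  have hBc : Bᶜ = {u | δ / μ < ‖u‖} := by
    ext u; simp [hB]
  have hint := integrable_gradient_shift hf hμ.ne' z
  have hB0 : γ B ≠ 0 := fun h0 =>
    (Metric.measure_closedBall_pos (volume : Measure (Z n m)) 0 (div_pos hδ hμ)).ne'
      (absolutelyContinuous_stdGaussian h0)
  have hgrad : ∀ᵐ u ∂(γ.restrict B),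
      ∇ f (z + μ • u) ∈ closure (goldsteinSubdifferential f δ z) := by
    filter_upwards [ae_restrict_of_ae (ae_differentiableAt_shift hf hμ.ne' z),
      ae_restrict_mem hBm] with u hu huB
    refine subset_closure (subset_convexHull ℝ _ (Set.mem_iUnion₂.2
      ⟨z + μ • u, ?_, gradient_mem_generalisedGradient hf hu⟩))
    rw [hB, mem_closedBall_zero_iff, le_div_iff₀ hμ] at huB
    rw [Metric.mem_closedBall, dist_eq_norm, add_sub_cancel_left, norm_smul,
      Real.norm_of_nonneg hμ.le, mul_comm]
    exact huB
  set a := ⨍ u in B, ∇ f (z + μ • u) ∂γ with ha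
  have haC : ‖a‖ ≤ C := by
    have : a ∈ Metric.closedBall (0 : Z n m) C :=
      (convex_closedBall 0 _).set_average_mem Metric.isClosed_closedBall hB0 (measure_ne_top _ _)
        (ae_of_all _ fun u => by simpa using norm_gradient_le hf (z + μ • u)) hint.integrableOn
    simpa using this
  refine ⟨a, (convex_convexHull ℝ _).closure.set_average_mem isClosed_closure hB0
    (measure_ne_top _ _) hgrad hint.integrableOn, ?_⟩
  have h1 : ∫ u in B, ∇ f (z + μ • u) ∂γ = γ.real B • a := by
    rw [ha, setAverage_eq, smul_smul, mul_inv_cancel₀, one_smul]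
    exact (measureReal_ne_zero_iff).2 hB0
  have h2 : γ.real B = 1 - γ.real Bᶜ := by
    rw [measureReal_compl hBm]; simp
  have h3 : ∇ (smoothed f μ) z - a =
      (∫ u in Bᶜ, ∇ f (z + μ • u) ∂γ) - γ.real Bᶜ • a := by
    rw [gradient_smoothed_eq_integral_gradient hf hμ.ne', ← integral_add_compl hBm hint, h1, h2,
      sub_smul, one_smul]
    abel
  have h4 : ‖∫ u in Bᶜ, ∇ f (z + μ • u) ∂γ‖ ≤ C * γ.real Bᶜ :=
    norm_setIntegral_le_of_norm_le_const (measure_lt_top _ _)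
      fun u _ => norm_gradient_le hf (z + μ • u)
  have h5 : ‖γ.real Bᶜ • a‖ ≤ γ.real Bᶜ * C := by
    rw [norm_smul, Real.norm_of_nonneg measureReal_nonneg]
    exact mul_le_mul_of_nonneg_left haC measureReal_nonneg
  rw [← hBc, h3]
  refine (norm_sub_le _ _).trans ?_
  linarith

/-- With the prescribed smoothing parameter the Gaussian mass of `{‖μ u‖ > δ}` is at most
`ε / (8 L₀)`. -/
lemma stdGaussian_real_norm_gt_le_of_smoothing_le (hd : 0 < n + m) {L₀ μ δ ε : ℝ} (hL₀ : 0 < L₀)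
    (hμ : 0 < μ) (hδ : 0 < δ) (hε : 0 < ε)
    (hμδ : μ ≤ δ / √((n + m : ℕ) * Real.pi * Real.exp 1)
      * (ε / (8 * L₀)) ^ (1 / ((n + m : ℕ) : ℝ))) :
    (stdGaussian (Z n m)).real {u | δ / μ < ‖u‖} ≤ ε / (8 * L₀) := by
  have hR : 0 < δ / μ := div_pos hδ hμ
  have h1 := stdGaussian_real_norm_gt_le (E := Z n m) (by rw [finrank_Z]; exact hd) hR
  rw [finrank_Z] at h1
  set d : ℝ := ((n + m : ℕ) : ℝ) with hd'
  have hdpos : 0 < d := by rw [hd']; exact_mod_cast hd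
  set q : ℝ := ε / (8 * L₀) with hq
  have hqpos : 0 < q := by positivity
  set x : ℝ := q ^ (1 / d) with hx
  have hxpos : 0 < x := by positivity
  have hpi : 0 < Real.pi := Real.pi_pos
  have he : 0 < Real.exp 1 := Real.exp_pos 1
  have hS : √(d * Real.pi * Real.exp 1) ≤ δ / μ * x := by
    have hSpos : 0 < √(d * Real.pi * Real.exp 1) := Real.sqrt_pos.2 (by positivity)
    rw [div_mul_eq_mul_div, le_div_iff₀ hSpos] at hμδ
    rw [div_mul_eq_mul_div, le_div_iff₀ hμ]
    linarith
  have hS2 : d * Real.pi * Real.exp 1 ≤ (δ / μ * x) ^ 2 := (Real.sqrt_le_left (by positivity)).1 hS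
  have h2 : 4 * d / (Real.exp 1 * (δ / μ) ^ 2) ≤ x ^ 2 := by
    rw [div_le_iff₀ (by positivity)]
    have h3 : (2 : ℝ) ≤ Real.exp 1 := by linarith [Real.add_one_le_exp (1 : ℝ)]
    have h4 : (1 : ℝ) ≤ Real.pi := by linarith [Real.pi_gt_three]
    calc 4 * d = 2 * (d * 1 * 2) := by ring
      _ ≤ Real.exp 1 * (d * Real.pi * Real.exp 1) := by gcongr
      _ ≤ Real.exp 1 * (δ / μ * x) ^ 2 := by gcongr
      _ = _ := by ring
  calc _ ≤ _ := h1
    _ ≤ (x ^ 2) ^ (d / 2) := by gcongr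
    _ = q := by
      rw [← Real.rpow_natCast, hx, ← Real.rpow_mul hqpos.le, ← Real.rpow_mul hqpos.le]
      convert Real.rpow_one q using 2
      field_simp; norm_num

/-- Up to `ε / 4`, the distance from `0` to the Goldstein subdifferential is bounded by the norm of
the operator `F_μ`. -/
lemma goldsteinResidual_le (hd : 0 < n + m) (hf : LipschitzWith C f) (hC : 0 < C) {μ δ ε : ℝ}
    (hμ : 0 < μ) (hδ : 0 < δ) (hε : 0 < ε)
    (hμδ : μ ≤ δ / √((n + m : ℕ) * Real.pi * Real.exp 1)
      * (ε / (8 * C)) ^ (1 / ((n + m : ℕ) : ℝ))) (z : Z n m) :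
    goldsteinResidual f δ z ≤ ENNReal.ofReal (‖smoothedOperator f μ z‖ + ε / 4) := by
  have hC' : (0 : ℝ) < C := hC
  obtain ⟨a, ha, hle⟩ := exists_mem_closure_goldsteinSubdifferential hf hμ hδ z
  have htail := stdGaussian_real_norm_gt_le_of_smoothing_le (n := n) (m := m) hd hC' hμ hδ hε hμδ
  refine (goldsteinResidual_le_of_mem_closure ha).trans ?_
  rw [← ofReal_norm, norm_smoothedOperator]
  refine ENNReal.ofReal_le_ofReal ?_
  have h1 : ‖a‖ ≤ ‖∇ (smoothed f μ) z‖ + ‖∇ (smoothed f μ) z - a‖ := by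
    have := norm_sub_norm_le a (∇ (smoothed f μ) z)
    rw [norm_sub_rev] at this
    linarith
  have h2 : 2 * C * (stdGaussian (Z n m)).real {u | δ / μ < ‖u‖} ≤ 2 * C * (ε / (8 * C)) := by
    gcongr
  have h3 : 2 * C * (ε / (8 * C)) = ε / 4 := by field_simp; norm_num
  linarith

end Clarke

/-! ### The variance of a mean of independent vectors -/

section Variance

variable {E : Type*} [NormedAddCommGroup E] [InnerProductSpace ℝ E]

lemma integrable_inner_of_memLp {α : Type*} [MeasurableSpace α] {P : Measure α} {X Y : α → E}
    (hX : MemLp X 2 P) (hY : MemLp Y 2 P) : Integrable (fun a => ⟪X a, Y a⟫_ℝ) P :=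
  (hX.norm.integrable_mul hY.norm).mono' (hX.1.inner hY.1)
    (ae_of_all _ fun a => abs_real_inner_le_norm (X a) (Y a))

variable [CompleteSpace E]

lemma integral_sq_norm_sub_smul {α : Type*} [MeasurableSpace α] {P : Measure α}
    [IsProbabilityMeasure P] {X : α → E} (hX : MemLp X 2 P) (h0 : ∫ a, X a ∂P = 0) (b : E) (h : ℝ) :
    ∫ a, ‖b - h • X a‖ ^ 2 ∂P = ‖b‖ ^ 2 + h ^ 2 * ∫ a, ‖X a‖ ^ 2 ∂P := by
  have h1 : ∀ a, ‖b - h • X a‖ ^ 2 = ‖b‖ ^ 2 - 2 * h * ⟪b, X a⟫_ℝ + h ^ 2 * ‖X a‖ ^ 2 := by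
    intro a
    rw [norm_sub_sq_real, real_inner_smul_right, norm_smul, mul_pow, Real.norm_eq_abs, sq_abs]
    ring
  have hi : Integrable X P := hX.integrable one_le_two
  have hin : Integrable (fun a => 2 * h * ⟪b, X a⟫_ℝ) P := (hi.const_inner b).const_mul _
  have hsq : Integrable (fun a => h ^ 2 * ‖X a‖ ^ 2) P := 
    (hX.integrable_norm_pow two_ne_zero).const_mul _
  have hbin : Integrable (fun a => ‖b‖ ^ 2 - 2 * h * ⟪b, X a⟫_ℝ) P := (integrable_const _).sub hin
  simp_rw [h1]
  rw [integral_add hbin hsq, integral_sub (integrable_const _) hin,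
    integral_const_mul, integral_const_mul, integral_inner hi, h0]
  simp

/-- The variance of a mean of `t` independent centred vectors is `1 / t` times that of one of
them. -/
lemma integral_sq_norm_mean_pi {α : Type*} [MeasurableSpace α] {γ : Measure α}
    [IsProbabilityMeasure γ] {X : α → E} (hX : MemLp X 2 γ) (h0 : ∫ a, X a ∂γ = 0) {t : ℕ} :
    ∫ w, ‖(t : ℝ)⁻¹ • ∑ i, X (w i)‖ ^ 2 ∂(Measure.pi fun _ : Fin t => γ) =
      (t : ℝ)⁻¹ * ∫ a, ‖X a‖ ^ 2 ∂γ := by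
  set ν := Measure.pi fun _ : Fin t => γ
  have hXi : ∀ i, MemLp (fun w : Fin t → α => X (w i)) 2 ν := fun i =>
    hX.comp_measurePreserving (measurePreserving_eval (fun _ : Fin t => γ) i)
  have hint : ∀ i j, Integrable (fun w : Fin t → α => ⟪X (w i), X (w j)⟫_ℝ) ν := fun i j =>
    integrable_inner_of_memLp (hXi i) (hXi j)
  have hdiag : ∀ i, ∫ w, ⟪X (w i), X (w i)⟫_ℝ ∂ν = ∫ a, ‖X a‖ ^ 2 ∂γ := by
    intro i
    simp_rw [real_inner_self_eq_norm_sq]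
    exact integral_comp_eval (μ := fun _ : Fin t => γ) (f := fun a => ‖X a‖ ^ 2) (i := i)
      (hX.1.norm.pow 2)
  have hoff : ∀ i j, i ≠ j → ∫ w, ⟪X (w i), X (w j)⟫_ℝ ∂ν = 0 := by
    intro i j hij
    have hind : IndepFun (fun w : Fin t → α => w i) (fun w => w j) ν :=
      (iIndepFun_pi (μ := fun _ : Fin t => γ) (X := fun _ a => a)
        fun _ => aemeasurable_id).indepFun hij
    have hlaw : ∀ i, HasLaw (fun w : Fin t → α => w i) γ ν := fun i =>
      ⟨(measurable_pi_apply i).aemeasurable,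
        (measurePreserving_eval (fun _ : Fin t => γ) i).map_eq⟩
    have hpair : HasLaw (fun w : Fin t → α => (w i, w j)) (γ.prod γ) ν :=
      hind.hasLaw_prod (hlaw i) (hlaw j)
    have hmeas : AEStronglyMeasurable (fun p : α × α => ⟪X p.1, X p.2⟫_ℝ) (γ.prod γ) :=
      hX.1.comp_fst.inner hX.1.comp_snd
    have hcomp := hpair.integral_comp hmeas
    have hintp : Integrable (fun p : α × α => ⟪X p.1, X p.2⟫_ℝ) (γ.prod γ) :=
      integrable_inner_of_memLp (hX.comp_fst γ) (hX.comp_snd γ)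
    refine hcomp.trans ?_
    rw [integral_prod _ hintp]
    simp_rw [integral_inner (hX.integrable one_le_two), h0, inner_zero_right, integral_zero]
  have hexp : ∀ w : Fin t → α, ‖(t : ℝ)⁻¹ • ∑ i, X (w i)‖ ^ 2 =
      (t : ℝ)⁻¹ ^ 2 * ∑ i, ∑ j, ⟪X (w i), X (w j)⟫_ℝ := by
    intro w
    rw [norm_smul, mul_pow, Real.norm_eq_abs, sq_abs, ← real_inner_self_eq_norm_sq, sum_inner]
    simp_rw [inner_sum]
  simp_rw [hexp]
  rw [integral_const_mul,
    integral_finsetSum _ fun i _ => integrable_finsetSum _ fun j _ => hint i j]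
  simp_rw [integral_finsetSum _ fun j _ => hint _ j]
  have hrow : ∀ i, ∑ j, ∫ w, ⟪X (w i), X (w j)⟫_ℝ ∂ν = ∫ a, ‖X a‖ ^ 2 ∂γ := by
    intro i
    rw [Finset.sum_eq_single i (fun j _ hj => hoff i j hj.symm) (by simp), hdiag]
  simp_rw [hrow]
  rw [Finset.sum_const, Finset.card_univ, Fintype.card_fin, nsmul_eq_mul, ← mul_assoc]
  congr 1
  rcases eq_or_ne (t : ℝ) 0 with ht | ht
  · simp [ht]
  · field_simp

end Variance

/-! ### One step of the method -/

/-- One extragradient step with error `x` in the extrapolation, `ẑ = z - h₁ (F z + x)`: the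
error enters quadratically and through a term that is linear in `x` with a coefficient
independent of `x`. -/
lemma sq_norm_extragradient_le {E : Type*} [NormedAddCommGroup E] [InnerProductSpace ℝ E]
    {F : E → E} {L ρ h₁ h₂ : ℝ} (hL : 0 < L) (hF : ∀ z w, ‖F z - F w‖ ≤ L * ‖z - w‖) (hρ : 0 ≤ ρ)
    (hh₂0 : 0 < h₂) (hh₁ : h₁ ≤ 1 / L) (hh₂ : h₂ ≤ h₁ / 2) {zstar : E}
    (hMVI : ∀ z, 0 ≤ ⟪F z, z - zstar⟫_ℝ + ρ / 2 * ‖F z‖ ^ 2) (z x zhat : E)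
    (hz : zhat = z - h₁ • (F z + x)) :
    ‖z - zstar - h₂ • F zhat‖ ^ 2 + (L * h₂ ^ 2 - ρ) / L * ‖F zhat‖ ^ 2 ≤
      ‖z - zstar‖ ^ 2 + 3 * h₁ * h₂ * ‖x‖ ^ 2 -
        2 * h₁ * h₂ * ⟪F (z - h₁ • F z) - F z, x⟫_ℝ := by
  have hh₁0 : 0 < h₁ := by linarith
  have hLh : L * h₁ ≤ 1 := by rwa [le_div_iff₀ hL, mul_comm] at hh₁
  set g := F z + x with hg
  have e1 : ‖z - zstar - h₂ • F zhat‖ ^ 2 =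
      ‖z - zstar‖ ^ 2 - 2 * h₂ * ⟪F zhat, z - zstar⟫_ℝ + h₂ ^ 2 * ‖F zhat‖ ^ 2 := by
    rw [norm_sub_sq_real, real_inner_smul_right, norm_smul, mul_pow, Real.norm_eq_abs, sq_abs,
      real_inner_comm]
    ring
  have e2 : ⟪F zhat, z - zstar⟫_ℝ = ⟪F zhat, zhat - zstar⟫_ℝ + h₁ * ⟪F zhat, g⟫_ℝ := by
    rw [← real_inner_smul_right, ← inner_add_right]
    congr 1
    rw [hz]; abel
  have e3 : 2 * ⟪F zhat, g⟫_ℝ = ‖F zhat‖ ^ 2 + ‖g‖ ^ 2 - ‖F zhat - g‖ ^ 2 := by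
    rw [norm_sub_sq_real]; ring
  have e4 : ‖F zhat - g‖ ^ 2 = ‖F zhat - F z‖ ^ 2 - 2 * ⟪F zhat - F z, x⟫_ℝ + ‖x‖ ^ 2 := by
    rw [← norm_sub_sq_real]; congr 2; rw [hg]; abel
  have e5 : ⟪F zhat - F z, x⟫_ℝ =
      ⟪F zhat - F (z - h₁ • F z), x⟫_ℝ + ⟪F (z - h₁ • F z) - F z, x⟫_ℝ := by
    rw [← inner_add_left]; congr 1; abel
  have i1 : ‖F zhat - F z‖ ^ 2 ≤ ‖g‖ ^ 2 := by
    have h1 := hF zhat z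
    rw [hz, sub_sub_cancel_left, norm_neg, norm_smul, Real.norm_of_nonneg hh₁0.le, ← mul_assoc,
      ← hz] at h1
    have h2 : L * h₁ * ‖g‖ ≤ 1 * ‖g‖ := mul_le_mul_of_nonneg_right hLh (norm_nonneg g)
    rw [one_mul] at h2
    exact pow_le_pow_left₀ (norm_nonneg _) (h1.trans h2) 2
  have i2 : -⟪F zhat - F (z - h₁ • F z), x⟫_ℝ ≤ ‖x‖ ^ 2 := by
    have h1 := hF zhat (z - h₁ • F z)
    have h2 : zhat - (z - h₁ • F z) = -(h₁ • x) := by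
      rw [hz, hg, smul_add]; abel
    rw [h2, norm_neg, norm_smul, Real.norm_of_nonneg hh₁0.le, ← mul_assoc] at h1
    have h3 : L * h₁ * ‖x‖ ≤ 1 * ‖x‖ := mul_le_mul_of_nonneg_right hLh (norm_nonneg x)
    rw [one_mul] at h3
    calc _ ≤ |⟪F zhat - F (z - h₁ • F z), x⟫_ℝ| := neg_le_abs _
      _ ≤ ‖F zhat - F (z - h₁ • F z)‖ * ‖x‖ := abs_real_inner_le_norm _ _
      _ ≤ ‖x‖ * ‖x‖ := mul_le_mul_of_nonneg_right (h1.trans h3) (norm_nonneg x)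
      _ = _ := (sq _).symm
  have i3 := hMVI zhat
  -- the coefficient of `‖F ẑ‖²`
  have i4 : (L * h₂ ^ 2 - ρ) / L + h₂ * ρ + h₂ ^ 2 - h₁ * h₂ ≤ 0 := by
    have h1 : (L * h₂ ^ 2 - ρ) / L = h₂ ^ 2 - ρ * (1 / L) := by field_simp
    have h2 : 2 * h₂ * h₂ ≤ h₁ * h₂ := mul_le_mul_of_nonneg_right (by linarith) hh₂0.le
    have h3 : h₂ * ρ ≤ 1 / L * ρ := mul_le_mul_of_nonneg_right (by linarith) hρ
    rw [h1]
    nlinarith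
  have i5 := mul_nonpos_of_nonpos_of_nonneg i4 (sq_nonneg ‖F zhat‖)
  have hp : 0 < h₁ * h₂ := mul_pos hh₁0 hh₂0
  have i6 : h₁ * h₂ * (‖F zhat - g‖ ^ 2 - ‖g‖ ^ 2) ≤
      h₁ * h₂ * (3 * ‖x‖ ^ 2 - 2 * ⟪F (z - h₁ • F z) - F z, x⟫_ℝ) := by
    refine mul_le_mul_of_nonneg_left ?_ hp.le
    linarith
  have i7 : 0 ≤ 2 * h₂ * (⟪F zhat, zhat - zstar⟫_ℝ + ρ / 2 * ‖F zhat‖ ^ 2) := by positivity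
  have e6 : 2 * h₂ * (h₁ * ⟪F zhat, g⟫_ℝ) =
      h₁ * h₂ * (‖F zhat‖ ^ 2 + ‖g‖ ^ 2 - ‖F zhat - g‖ ^ 2) := by rw [← e3]; ring
  rw [e1, e2, mul_add, e6]
  linarith

section AveragedOracle

variable {n m : ℕ} {f : Z n m → ℝ} {C : NNReal} {t : ℕ}

lemma continuous_averagedOracle (hf : LipschitzWith C f) (μ : ℝ) :
    Continuous fun p : Z n m × (Fin t → Z n m) => averagedOracle f μ p.1 p.2 := by
  have h : ∀ i : Fin t, Continuous fun p : Z n m × (Fin t → Z n m) => oracle f μ p.1 (p.2 i) :=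
    fun i => (continuous_oracle hf μ).comp
      (by fun_prop : Continuous fun p : Z n m × (Fin t → Z n m) => (p.1, p.2 i))
  have hsum : Continuous fun p : Z n m × (Fin t → Z n m) => ∑ i, oracle f μ p.1 (p.2 i) :=
    continuous_finsetSum _ fun i _ => h i
  exact hsum.const_smul (t : ℝ)⁻¹

lemma norm_averagedOracle_le (hf : LipschitzWith C f) {μ : ℝ} (hμ : 0 < μ) (z : Z n m)
    (w : Fin t → Z n m) :
    ‖averagedOracle f μ z w‖ ≤ (t : ℝ)⁻¹ * ∑ i, C * ‖w i‖ ^ 2 := by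
  rw [averagedOracle, norm_smul, Real.norm_of_nonneg (by positivity)]
  gcongr
  exact norm_sum_le_of_le _ fun i _ => norm_oracle_le hf hμ z (w i)

/-- The joint law of the `t` directions of one oracle call. -/
noncomputable abbrev directionLaw (n m t : ℕ) : Measure (Fin t → Z n m) :=
  Measure.pi fun _ => stdGaussian (Z n m)

lemma averagedOracle_sub_smoothedOperator (ht : 0 < t) (μ : ℝ) (z : Z n m) (w : Fin t → Z n m) :
    averagedOracle f μ z w - smoothedOperator f μ z =
      (t : ℝ)⁻¹ • ∑ i, (oracle f μ z (w i) - smoothedOperator f μ z) := by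
  have ht' : (t : ℝ) ≠ 0 := by exact_mod_cast ht.ne'
  rw [averagedOracle, Finset.sum_sub_distrib, smul_sub, Finset.sum_const, Finset.card_univ,
    Fintype.card_fin, ← Nat.cast_smul_eq_nsmul ℝ, smul_smul, inv_mul_cancel₀ ht', one_smul]

lemma memLp_averagedOracle (hf : LipschitzWith C f) {μ : ℝ} (hμ : 0 < μ) (z : Z n m) :
    MemLp (averagedOracle f μ z) 2 (directionLaw n m t) := by
  have h : ∀ i : Fin t, MemLp (fun w : Fin t → Z n m => oracle f μ z (w i)) 2
      (directionLaw n m t) := fun i =>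
    (memLp_oracle hf hμ z).comp_measurePreserving
      (measurePreserving_eval (fun _ : Fin t => stdGaussian (Z n m)) i)
  have hsum : MemLp (fun w : Fin t → Z n m => ∑ i, oracle f μ z (w i)) 2 (directionLaw n m t) :=
    memLp_finsetSum _ fun i _ => h i
  exact hsum.const_smul (t : ℝ)⁻¹

lemma memLp_averagedOracle_sub (hf : LipschitzWith C f) {μ : ℝ} (hμ : 0 < μ) (z : Z n m) :
    MemLp (fun w => averagedOracle f μ z w - smoothedOperator f μ z) 2 (directionLaw n m t) :=
  (memLp_averagedOracle hf hμ z).sub (memLp_const _)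

lemma integral_averagedOracle_sub (hf : LipschitzWith C f) {μ : ℝ} (hμ : 0 < μ) (ht : 0 < t)
    (z : Z n m) :
    ∫ w, (averagedOracle f μ z w - smoothedOperator f μ z) ∂(directionLaw n m t) = 0 := by
  have hi : Integrable (fun u => oracle f μ z u - smoothedOperator f μ z) (stdGaussian (Z n m)) :=
    ((memLp_oracle hf hμ z).integrable one_le_two).sub (integrable_const _)
  simp_rw [averagedOracle_sub_smoothedOperator ht]
  rw [integral_smul, integral_finsetSum]
  · have h1 : ∀ i : Fin t, ∫ w, (oracle f μ z (w i) - smoothedOperator f μ z)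
        ∂(directionLaw n m t) = 0 := fun i =>
      (integral_comp_eval (μ := fun _ : Fin t => stdGaussian (Z n m))
        (f := fun u => oracle f μ z u - smoothedOperator f μ z) (i := i)
        hi.1).trans (integral_oracle_sub hf hμ z)
    simp_rw [h1]
    simp
  · intro i _
    exact (measurePreserving_eval (fun _ : Fin t => stdGaussian (Z n m)) i)
      |>.integrable_comp_of_integrable hi

lemma integral_sq_norm_averagedOracle_sub_le (hf : LipschitzWith C f) {μ : ℝ} (hμ : 0 < μ)
    (ht : 0 < t) {σ : ℝ}
    (hσ : ∀ z, ∫ u, ‖oracle f μ z u - smoothedOperator f μ z‖ ^ 2 ∂(stdGaussian (Z n m)) ≤ σ ^ 2)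
    (z : Z n m) :
    ∫ w, ‖averagedOracle f μ z w - smoothedOperator f μ z‖ ^ 2 ∂(directionLaw n m t) ≤
      σ ^ 2 / t := by
  simp_rw [averagedOracle_sub_smoothedOperator ht]
  rw [integral_sq_norm_mean_pi (X := fun u => oracle f μ z u - smoothedOperator f μ z)
    ((memLp_oracle hf hμ z).sub (memLp_const _)) (integral_oracle_sub hf hμ z), div_eq_inv_mul]
  gcongr
  exact hσ z

lemma norm_smoothedOperator_sub (f : Z n m → ℝ) (μ : ℝ) (z w : Z n m) :
    ‖smoothedOperator f μ z - smoothedOperator f μ w‖ =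
      ‖∇ (smoothed f μ) z - ∇ (smoothed f μ) w‖ := by
  rw [smoothedOperator, smoothedOperator, signFlip_sub, norm_signFlip]

/-- The expected decrease of the squared distance to the solution in one step of the method, for a
fixed current iterate. -/
lemma integral_step_le (hf : LipschitzWith C f) {μ : ℝ} (hμ : 0 < μ)
    (ht : 0 < t) {σ : ℝ}
    (hσ : ∀ z, ∫ u, ‖oracle f μ z u - smoothedOperator f μ z‖ ^ 2 ∂(stdGaussian (Z n m)) ≤ σ ^ 2)
    {L ρ h₁ h₂ : ℝ} (hL : 0 < L)
    (hgrad : ∀ z w, ‖∇ (smoothed f μ) z - ∇ (smoothed f μ) w‖ ≤ L * ‖z - w‖) (hρ : 0 ≤ ρ)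
    (hh₂0 : 0 < h₂) (hh₁ : h₁ ≤ 1 / L) (hh₂ : h₂ ≤ h₁ / 2) (hD : 0 ≤ (L * h₂ ^ 2 - ρ) / L)
    {zstar : Z n m}
    (hMVI : ∀ z, 0 ≤ ⟪smoothedOperator f μ z, z - zstar⟫_ℝ
      + ρ / 2 * ‖smoothedOperator f μ z‖ ^ 2) (z : Z n m) :
    ∫ what, ∫ w, (‖z - h₂ • averagedOracle f μ (extrapolate f μ h₁ z what) w - zstar‖ ^ 2 +
        (L * h₂ ^ 2 - ρ) / L * ‖smoothedOperator f μ (extrapolate f μ h₁ z what)‖ ^ 2)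
        ∂(directionLaw n m t) ∂(directionLaw n m t) ≤
      ‖z - zstar‖ ^ 2 + (3 * h₁ * h₂ + h₂ ^ 2) * (σ ^ 2 / t) := by
  set F := smoothedOperator f μ with hFdef
  set D := (L * h₂ ^ 2 - ρ) / L with hDdef
  have hF : ∀ z w, ‖F z - F w‖ ≤ L * ‖z - w‖ := fun z w =>
    (norm_smoothedOperator_sub f μ z w).trans_le (hgrad z w)
  set v := F (z - h₁ • F z) - F z with hv
  have hh₁0 : 0 < h₁ := by linarith
  have hinner : ∀ what : Fin t → Z n m,
      ∫ w, (‖z - h₂ • averagedOracle f μ (extrapolate f μ h₁ z what) w - zstar‖ ^ 2 +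
        D * ‖F (extrapolate f μ h₁ z what)‖ ^ 2) ∂(directionLaw n m t) ≤
      ‖z - zstar‖ ^ 2 + h₂ ^ 2 * (σ ^ 2 / t) +
        3 * h₁ * h₂ * ‖averagedOracle f μ z what - F z‖ ^ 2 -
        2 * h₁ * h₂ * ⟪v, averagedOracle f μ z what - F z⟫_ℝ := by
    intro what
    set zhat := extrapolate f μ h₁ z what with hzhat
    have h1 : ∀ w : Fin t → Z n m, z - h₂ • averagedOracle f μ zhat w - zstar =
        (z - zstar - h₂ • F zhat) - h₂ • (averagedOracle f μ zhat w - F zhat) := by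
      intro w; rw [smul_sub]; abel
    have hmem := memLp_averagedOracle_sub (t := t) hf hμ zhat
    have hint : Integrable (fun w => ‖(z - zstar - h₂ • F zhat) -
        h₂ • (averagedOracle f μ zhat w - F zhat)‖ ^ 2) (directionLaw n m t) :=
      ((memLp_const _).sub (hmem.const_smul h₂)).integrable_norm_pow two_ne_zero
    simp_rw [h1]
    rw [integral_add hint (integrable_const _),
      integral_sq_norm_sub_smul hmem (integral_averagedOracle_sub hf hμ ht zhat)]
    have h2 := sq_norm_extragradient_le hL hF hρ hh₂0 hh₁ hh₂ hMVI z
      (averagedOracle f μ z what - F z) zhat (by rw [hzhat, extrapolate]; congr 2; abel)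
    have h3 : h₂ ^ 2 * ∫ w, ‖averagedOracle f μ zhat w - F zhat‖ ^ 2 ∂(directionLaw n m t) ≤
        h₂ ^ 2 * (σ ^ 2 / t) := by
      gcongr
      exact integral_sq_norm_averagedOracle_sub_le hf hμ ht hσ zhat
    simp only [integral_const, probReal_univ, one_smul]
    linarith
  have hmem := memLp_averagedOracle_sub (t := t) hf hμ z
  have hi1 : Integrable (fun what => 3 * h₁ * h₂ * ‖averagedOracle f μ z what - F z‖ ^ 2)
      (directionLaw n m t) := (hmem.integrable_norm_pow two_ne_zero).const_mul _
  have hi2 : Integrable (fun what => 2 * h₁ * h₂ * ⟪v, averagedOracle f μ z what - F z⟫_ℝ)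
      (directionLaw n m t) := ((hmem.integrable one_le_two).const_inner v).const_mul _
  refine (integral_mono_of_nonneg
    (ae_of_all _ fun what => integral_nonneg fun w => by positivity)
    (((integrable_const _).add hi1).sub hi2) (ae_of_all _ hinner)).trans ?_
  simp only [Pi.add_apply, Pi.sub_apply]
  have hi0 : Integrable (fun what => ‖z - zstar‖ ^ 2 + h₂ ^ 2 * (σ ^ 2 / t) +
      3 * h₁ * h₂ * ‖averagedOracle f μ z what - F z‖ ^ 2) (directionLaw n m t) :=
    (integrable_const _).add hi1
  rw [integral_sub hi0 hi2, integral_add (integrable_const _) hi1, integral_const_mul,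
    integral_const_mul, integral_inner (hmem.integrable one_le_two),
    integral_averagedOracle_sub hf hμ ht z, inner_zero_right]
  have h4 : 3 * h₁ * h₂ * ∫ w, ‖averagedOracle f μ z w - F z‖ ^ 2 ∂(directionLaw n m t) ≤
      3 * h₁ * h₂ * (σ ^ 2 / t) := by
    gcongr
    exact integral_sq_norm_averagedOracle_sub_le hf hμ ht hσ z
  simp only [integral_const, probReal_univ, one_smul]
  linarith

end AveragedOracle

/-! ### The random iterates -/

section Iterates

variable {n m : ℕ} {f : Z n m → ℝ} {C : NNReal} {t : ℕ}

lemma iterate_congr (f : Z n m → ℝ) (μ h₁ h₂ : ℝ) (z₀ : Z n m) {uhat u uhat' u' : ℕ → Fin t → Z n m}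
    {k : ℕ} (h : ∀ j < k, uhat j = uhat' j ∧ u j = u' j) :
    iterate f μ h₁ h₂ z₀ uhat u k = iterate f μ h₁ h₂ z₀ uhat' u' k := by
  induction k with
  | zero => rfl
  | succ k ih =>
    have hk := h k (Nat.lt_succ_self k)
    rw [iterate, iterate, ih fun j hj => h j (hj.trans (Nat.lt_succ_self k)), hk.1, hk.2]

lemma measurable_averagedOracle (hf : LipschitzWith C f) (μ : ℝ) {X : Type*} [MeasurableSpace X]
    {a : X → Z n m} {w : X → Fin t → Z n m} (ha : Measurable a) (hw : Measurable w) :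
    Measurable fun x => averagedOracle f μ (a x) (w x) := by
  have h := (continuous_averagedOracle (t := t) hf μ).measurable
  have h' := h.comp (ha.prodMk hw)
  simpa only [Function.comp_def] using h'

lemma measurable_extrapolate (hf : LipschitzWith C f) (μ h₁ : ℝ) {X : Type*} [MeasurableSpace X]
    {a : X → Z n m} {w : X → Fin t → Z n m} (ha : Measurable a) (hw : Measurable w) :
    Measurable fun x => extrapolate f μ h₁ (a x) (w x) :=
  ha.sub ((measurable_averagedOracle hf μ ha hw).const_smul h₁)

lemma measurable_iterate (hf : LipschitzWith C f) (μ h₁ h₂ : ℝ) (z₀ : Z n m) {X : Type*}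
    [MeasurableSpace X] {uhat u : X → ℕ → Fin t → Z n m} (huhat : ∀ j, Measurable fun x => uhat x j)
    (hu : ∀ j, Measurable fun x => u x j) (k : ℕ) :
    Measurable fun x => iterate f μ h₁ h₂ z₀ (uhat x) (u x) k := by
  induction k with
  | zero => exact measurable_const
  | succ k ih =>
    have h1 := measurable_extrapolate hf μ h₁ ih (huhat k)
    exact ih.sub ((measurable_averagedOracle hf μ h1 (hu k)).const_smul h₂)

lemma continuous_smoothedOperator {μ L : ℝ}
    (hgrad : ∀ z w, ‖∇ (smoothed f μ) z - ∇ (smoothed f μ) w‖ ≤ L * ‖z - w‖) :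
    Continuous (smoothedOperator f μ) :=
  continuous_signFlip.comp (LipschitzWith.of_dist_le' (K := L) fun z w => by
    rw [dist_eq_norm, dist_eq_norm]; exact hgrad z w).continuous

variable {Ω : Type*} [MeasurableSpace Ω] {P : Measure Ω}

lemma memLp_averagedOracle_comp (hf : LipschitzWith C f) {μ : ℝ} (hμ : 0 < μ) {X : Ω → Z n m}
    {W : Ω → Fin t → Z n m} (hX : AEMeasurable X P) (hW : HasLaw W (directionLaw n m t) P) :
    MemLp (fun ω => averagedOracle f μ (X ω) (W ω)) 2 P := by
  have hg : MemLp (fun w : Fin t → Z n m => (t : ℝ)⁻¹ * ∑ i, C * ‖w i‖ ^ 2) 2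
      (directionLaw n m t) := by
    have h1 : ∀ i : Fin t, MemLp (fun w : Fin t → Z n m => C * ‖w i‖ ^ 2) 2
        (directionLaw n m t) := fun i =>
      (memLp_mul_sq_norm_stdGaussian C).comp_measurePreserving
        (measurePreserving_eval (fun _ : Fin t => stdGaussian (Z n m)) i)
    exact (memLp_finsetSum _ fun i _ => h1 i).const_mul _
  have hgW : MemLp (fun ω => (t : ℝ)⁻¹ * ∑ i, C * ‖W ω i‖ ^ 2) 2 P := by
    rw [← hW.map_eq] at hg
    exact hg.comp_of_map hW.aemeasurable
  exact hgW.mono' ((continuous_averagedOracle (t := t) hf μ).measurable.comp_aemeasurable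
    (hX.prodMk hW.aemeasurable)).aestronglyMeasurable
    (ae_of_all _ fun ω => norm_averagedOracle_le hf hμ (X ω) (W ω))

/-- The expected decrease in one step of the method, when the current iterate `X` is independent of
the new directions `What`, `W`. -/
lemma integral_sq_norm_step_le [IsProbabilityMeasure P] (hf : LipschitzWith C f) {μ : ℝ}
    (hμ : 0 < μ)
    (ht : 0 < t) {σ : ℝ}
    (hσ : ∀ z, ∫ u, ‖oracle f μ z u - smoothedOperator f μ z‖ ^ 2 ∂(stdGaussian (Z n m)) ≤ σ ^ 2)
    {L ρ h₁ h₂ : ℝ} (hL : 0 < L)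
    (hgrad : ∀ z w, ‖∇ (smoothed f μ) z - ∇ (smoothed f μ) w‖ ≤ L * ‖z - w‖) (hρ : 0 ≤ ρ)
    (hh₂0 : 0 < h₂) (hh₁ : h₁ ≤ 1 / L) (hh₂ : h₂ ≤ h₁ / 2) (hD : 0 ≤ (L * h₂ ^ 2 - ρ) / L)
    {zstar : Z n m}
    (hMVI : ∀ z, 0 ≤ ⟪smoothedOperator f μ z, z - zstar⟫_ℝ
      + ρ / 2 * ‖smoothedOperator f μ z‖ ^ 2) {X : Ω → Z n m} (hX : MemLp X 2 P)
    {What W : Ω → Fin t → Z n m}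
    (hlaw : HasLaw (fun ω => (What ω, W ω)) ((directionLaw n m t).prod (directionLaw n m t)) P)
    (hind : IndepFun X (fun ω => (What ω, W ω)) P) :
    MemLp (fun ω => X ω - h₂ • averagedOracle f μ (extrapolate f μ h₁ (X ω) (What ω)) (W ω)) 2 P ∧
    ∫ ω, ‖X ω - h₂ • averagedOracle f μ (extrapolate f μ h₁ (X ω) (What ω)) (W ω) - zstar‖ ^ 2 ∂P +
      (L * h₂ ^ 2 - ρ) / L * ∫ ω, ‖smoothedOperator f μ (extrapolate f μ h₁ (X ω) (What ω))‖ ^ 2 ∂P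
      ≤ ∫ ω, ‖X ω - zstar‖ ^ 2 ∂P + (3 * h₁ * h₂ + h₂ ^ 2) * (σ ^ 2 / t) := by
  set D := (L * h₂ ^ 2 - ρ) / L with hDdef
  have hWhat : HasLaw What (directionLaw n m t) P := measurePreserving_fst.fun_comp_hasLaw hlaw
  have hW : HasLaw W (directionLaw n m t) P := measurePreserving_snd.fun_comp_hasLaw hlaw
  have hXm : AEMeasurable X P := hX.1.aemeasurable
  have hXhat : AEMeasurable (fun ω => extrapolate f μ h₁ (X ω) (What ω)) P :=
    (measurable_extrapolate hf μ h₁ measurable_fst measurable_snd).comp_aemeasurable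
      (hXm.prodMk hWhat.aemeasurable)
  have hFc := continuous_smoothedOperator hgrad
  have hnext : MemLp (fun ω =>
      X ω - h₂ • averagedOracle f μ (extrapolate f μ h₁ (X ω) (What ω)) (W ω)) 2 P :=
    hX.sub ((memLp_averagedOracle_comp hf hμ hXhat hW).const_smul h₂)
  refine ⟨hnext, ?_⟩
  set H : Z n m × ((Fin t → Z n m) × (Fin t → Z n m)) → ℝ := fun p =>
    ‖p.1 - h₂ • averagedOracle f μ (extrapolate f μ h₁ p.1 p.2.1) p.2.2 - zstar‖ ^ 2 +
      D * ‖smoothedOperator f μ (extrapolate f μ h₁ p.1 p.2.1)‖ ^ 2 with hH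
  have hHm : Measurable H := by
    have h1 : Measurable fun p : Z n m × ((Fin t → Z n m) × (Fin t → Z n m)) =>
        extrapolate f μ h₁ p.1 p.2.1 :=
      measurable_extrapolate hf μ h₁ measurable_fst measurable_snd.fst
    have h2 : Measurable fun p : Z n m × ((Fin t → Z n m) × (Fin t → Z n m)) =>
        averagedOracle f μ (extrapolate f μ h₁ p.1 p.2.1) p.2.2 :=
      measurable_averagedOracle hf μ h1 measurable_snd.snd
    exact (((measurable_fst.sub (h2.const_smul h₂)).sub_const zstar).norm.pow_const 2).add
      (((hFc.measurable.comp h1).norm.pow_const 2).const_mul D)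
  have hi1 : Integrable (fun ω =>
      ‖X ω - h₂ • averagedOracle f μ (extrapolate f μ h₁ (X ω) (What ω)) (W ω) - zstar‖ ^ 2) P :=
    (hnext.sub (memLp_const zstar)).integrable_norm_pow two_ne_zero
  have hi2 : Integrable (fun ω =>
      ‖smoothedOperator f μ (extrapolate f μ h₁ (X ω) (What ω))‖ ^ 2) P := by
    refine (integrable_const ((C : ℝ) ^ 2)).mono'
      ((hFc.measurable.comp_aemeasurable hXhat).norm.pow_const 2).aestronglyMeasurable
      (ae_of_all _ fun ω => ?_)
    rw [Real.norm_of_nonneg (by positivity), norm_smoothedOperator]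
    exact pow_le_pow_left₀ (norm_nonneg _) (norm_gradient_smoothed_le hf hμ.ne' _) 2
  have hpair : HasLaw (fun ω => (X ω, (What ω, W ω)))
      ((P.map X).prod ((directionLaw n m t).prod (directionLaw n m t))) P :=
    have : IsProbabilityMeasure (P.map X) := Measure.isProbabilityMeasure_map hXm
    hind.hasLaw_prod ⟨hXm, rfl⟩ hlaw
  have : IsProbabilityMeasure (P.map X) := Measure.isProbabilityMeasure_map hXm
  have hHi : Integrable H ((P.map X).prod ((directionLaw n m t).prod (directionLaw n m t))) := by
    rw [← hpair.map_eq, integrable_map_measure hHm.aestronglyMeasurable hpair.aemeasurable]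
    exact hi1.add (hi2.const_mul D)
  have hXi : Integrable (fun x => ‖x - zstar‖ ^ 2 + (3 * h₁ * h₂ + h₂ ^ 2) * (σ ^ 2 / t))
      (P.map X) := by
    refine Integrable.add ?_ (integrable_const _)
    rw [integrable_map_measure (by fun_prop) hXm]
    exact (hX.sub (memLp_const zstar)).integrable_norm_pow two_ne_zero
  calc _ = ∫ ω, H (X ω, (What ω, W ω)) ∂P := by
        rw [hH, integral_add hi1 (hi2.const_mul D), integral_const_mul]
    _ = ∫ p, H p ∂((P.map X).prod ((directionLaw n m t).prod (directionLaw n m t))) :=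
        hpair.integral_comp hHm.aestronglyMeasurable
    _ = ∫ x, ∫ q, H (x, q) ∂((directionLaw n m t).prod (directionLaw n m t)) ∂(P.map X) :=
        integral_prod _ hHi
    _ ≤ ∫ x, (‖x - zstar‖ ^ 2 + (3 * h₁ * h₂ + h₂ ^ 2) * (σ ^ 2 / t)) ∂(P.map X) := by
        refine integral_mono_ae hHi.integral_prod_left hXi ?_
        filter_upwards [hHi.prod_right_ae] with x hx
        rw [integral_prod _ hx]
        exact integral_step_le hf hμ ht hσ hL hgrad hρ hh₂0 hh₁ hh₂ hD hMVI x
    _ = _ := by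
        rw [integral_map hXm (by fun_prop), integral_add _ (integrable_const _)]
        · simp
        · exact (hX.sub (memLp_const zstar)).integrable_norm_pow two_ne_zero

/-- The iterate `z_k` depends only on the directions with index less than `k`, hence is measurable
and independent of the directions with index `k`. -/
lemma indepFun_iterate (hf : LipschitzWith C f) (μ h₁ h₂ : ℝ) (z₀ : Z n m) {N : ℕ}
    {uhat u : ℕ → Fin t → Ω → Z n m}
    (huhat : ∀ k ≤ N, ∀ i, HasLaw (uhat k i) (stdGaussian (Z n m)) P)
    (hu : ∀ k ≤ N, ∀ i, HasLaw (u k i) (stdGaussian (Z n m)) P)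
    (hindep : iIndepFun (fun p : (Fin (N + 1) × Fin t) ⊕ (Fin (N + 1) × Fin t) =>
      Sum.elim (fun q => uhat q.1 q.2) (fun q => u q.1 q.2) p) P) {k : ℕ} (hk : k ≤ N) :
    AEMeasurable (fun ω => iterate f μ h₁ h₂ z₀ (fun j i => uhat j i ω) (fun j i => u j i ω) k) P ∧
    HasLaw (fun ω => ((fun i => uhat k i ω), (fun i => u k i ω)))
      ((directionLaw n m t).prod (directionLaw n m t)) P ∧
    IndepFun (fun ω => iterate f μ h₁ h₂ z₀ (fun j i => uhat j i ω) (fun j i => u j i ω) k)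
      (fun ω => ((fun i => uhat k i ω), (fun i => u k i ω))) P := by
  classical
  set V : (Fin (N + 1) × Fin t) ⊕ (Fin (N + 1) × Fin t) → Ω → Z n m := fun p =>
    Sum.elim (fun q => uhat q.1 q.2) (fun q => u q.1 q.2) p with hV
  have hVlaw : ∀ p, HasLaw (V p) (stdGaussian (Z n m)) P := by
    rintro (q | q)
    · exact huhat q.1 (Nat.lt_succ_iff.1 q.1.2) q.2
    · exact hu q.1 (Nat.lt_succ_iff.1 q.1.2) q.2
  have hVm : ∀ p, AEMeasurable (V p) P := fun p => (hVlaw p).aemeasurable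
  let level : (Fin (N + 1) × Fin t) ⊕ (Fin (N + 1) × Fin t) → ℕ :=
    Sum.elim (fun q => q.1) (fun q => q.1)
  let S : Finset ((Fin (N + 1) × Fin t) ⊕ (Fin (N + 1) × Fin t)) :=
    Finset.univ.filter fun p => level p < k
  let T : Finset ((Fin (N + 1) × Fin t) ⊕ (Fin (N + 1) × Fin t)) :=
    Finset.univ.filter fun p => level p = k
  have hST : Disjoint S T := by
    refine Finset.disjoint_left.2 fun p hp hp' => ?_
    exact ((Finset.mem_filter.1 hp).2).ne (Finset.mem_filter.1 hp').2
  have hmemS : ∀ {j : ℕ} (hj : j < k) (i : Fin t),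
      (Sum.inl (⟨j, by omega⟩, i) : (Fin (N + 1) × Fin t) ⊕ (Fin (N + 1) × Fin t)) ∈ S ∧
      (Sum.inr (⟨j, by omega⟩, i) : (Fin (N + 1) × Fin t) ⊕ (Fin (N + 1) × Fin t)) ∈ S :=
    fun hj i => ⟨Finset.mem_filter.2 ⟨Finset.mem_univ _, hj⟩,
      Finset.mem_filter.2 ⟨Finset.mem_univ _, hj⟩⟩
  have hmemT : ∀ i : Fin t,
      (Sum.inl (⟨k, by omega⟩, i) : (Fin (N + 1) × Fin t) ⊕ (Fin (N + 1) × Fin t)) ∈ T ∧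
      (Sum.inr (⟨k, by omega⟩, i) : (Fin (N + 1) × Fin t) ⊕ (Fin (N + 1) × Fin t)) ∈ T :=
    fun i => ⟨Finset.mem_filter.2 ⟨Finset.mem_univ _, rfl⟩,
      Finset.mem_filter.2 ⟨Finset.mem_univ _, rfl⟩⟩
  -- `z_k` as a measurable function of the past directions, padded by zeros
  let padl : (S → Z n m) → ℕ → Fin t → Z n m := fun x j i =>
    if hj : j < k then x ⟨_, (hmemS hj i).1⟩ else 0
  let padr : (S → Z n m) → ℕ → Fin t → Z n m := fun x j i =>
    if hj : j < k then x ⟨_, (hmemS hj i).2⟩ else 0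
  have hpadl : ∀ j, Measurable fun x => padl x j := by
    intro j
    refine measurable_pi_lambda _ fun i => ?_
    by_cases hj : j < k
    · simp only [padl, dif_pos hj]; exact measurable_pi_apply _
    · simp only [padl, dif_neg hj]; exact measurable_const
  have hpadr : ∀ j, Measurable fun x => padr x j := by
    intro j
    refine measurable_pi_lambda _ fun i => ?_
    by_cases hj : j < k
    · simp only [padr, dif_pos hj]; exact measurable_pi_apply _
    · simp only [padr, dif_neg hj]; exact measurable_const
  let Φ : (S → Z n m) → Z n m := fun x => iterate f μ h₁ h₂ z₀ (padl x) (padr x) k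
  have hΦ : Measurable Φ := measurable_iterate hf μ h₁ h₂ z₀ hpadl hpadr k
  let Ψ : (T → Z n m) → (Fin t → Z n m) × (Fin t → Z n m) := fun x =>
    (fun i => x ⟨_, (hmemT i).1⟩, fun i => x ⟨_, (hmemT i).2⟩)
  have hΨ : Measurable Ψ :=
    (measurable_pi_lambda _ fun i => measurable_pi_apply _).prodMk
      (measurable_pi_lambda _ fun i => measurable_pi_apply _)
  have hpast : (fun ω => iterate f μ h₁ h₂ z₀ (fun j i => uhat j i ω) (fun j i => u j i ω) k) =
      Φ ∘ fun ω (p : S) => V p ω := by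
    funext ω
    refine iterate_congr f μ h₁ h₂ z₀ fun j hj => ⟨?_, ?_⟩
    · funext i; simp only [padl, dif_pos hj]; rfl
    · funext i; simp only [padr, dif_pos hj]; rfl
  have hind := (hindep.indepFun_finset₀ S T hST hVm).comp hΦ hΨ
  refine ⟨?_, ?_, ?_⟩
  · rw [hpast]
    exact hΦ.comp_aemeasurable (aemeasurable_pi_lambda _ fun p => hVm p)
  · let g : Fin t ⊕ Fin t → (Fin (N + 1) × Fin t) ⊕ (Fin (N + 1) × Fin t) :=
      Sum.map (fun i => (⟨k, by omega⟩, i)) (fun i => (⟨k, by omega⟩, i))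
    have hg : g.Injective := by
      refine Function.Injective.sumMap ?_ ?_ <;>
      · intro i j hij
        exact (Prod.ext_iff.1 hij).2
    have h1 : HasLaw (fun ω p => V (g p) ω)
        (Measure.pi fun _ : Fin t ⊕ Fin t => stdGaussian (Z n m)) P :=
      (hindep.precomp hg).hasLaw_pi fun p => hVlaw (g p)
    exact (measurePreserving_sumPiEquivProdPi
      (fun _ : Fin t ⊕ Fin t => stdGaussian (Z n m))).fun_comp_hasLaw h1
  · rw [hpast]
    exact hind

end Iterates

/-! ### Convergence of the method -/

/-- Telescoping a recursion `a (k + 1) + D b k ≤ a k + c` and choosing the smallest `b k`. -/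
lemma exists_mul_le_of_forall_add_le {a b : ℕ → ℝ} {D c : ℝ} {N : ℕ} (ha : ∀ k, 0 ≤ a k)
    (h : ∀ k ≤ N, a (k + 1) + D * b k ≤ a k + c) :
    ∃ k ≤ N, (N + 1) * (D * b k) ≤ a 0 + (N + 1) * c := by
  have hsum : ∀ M ≤ N + 1, a M + ∑ k ∈ Finset.range M, D * b k ≤ a 0 + M * c := by
    intro M hM
    induction M with
    | zero => simp
    | succ M ih =>
      rw [Finset.sum_range_succ]
      push_cast
      linarith [ih (by omega), h M (by omega)]
  by_contra! hcon
  have h1 : ∑ _k ∈ Finset.range (N + 1), (a 0 + (N + 1) * c) <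
      ∑ k ∈ Finset.range (N + 1), (N + 1) * (D * b k) :=
    Finset.sum_lt_sum_of_nonempty (by simp) fun k hk =>
      hcon k (Nat.lt_succ_iff.1 (Finset.mem_range.1 hk))
  rw [Finset.sum_const, Finset.card_range, nsmul_eq_mul, ← Finset.mul_sum] at h1
  push_cast at h1
  have h2 := lt_of_mul_lt_mul_left h1 (by positivity)
  have h3 := hsum (N + 1) le_rfl
  push_cast at h3
  linarith [ha (N + 1)]

variable {n m : ℕ} {f : Z n m → ℝ} {C : NNReal} {t : ℕ} {Ω : Type*} [MeasurableSpace Ω]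
  {P : Measure Ω} [IsProbabilityMeasure P]

/-- After `N + 1` steps some extrapolated iterate has a small expected squared operator norm. -/
lemma exists_integral_sq_norm_smoothedOperator_le (hf : LipschitzWith C f) {μ : ℝ} (hμ : 0 < μ)
    (ht : 0 < t) {σ : ℝ}
    (hσ : ∀ z, ∫ u, ‖oracle f μ z u - smoothedOperator f μ z‖ ^ 2 ∂(stdGaussian (Z n m)) ≤ σ ^ 2)
    {L ρ h₁ h₂ : ℝ} (hL : 0 < L)
    (hgrad : ∀ z w, ‖∇ (smoothed f μ) z - ∇ (smoothed f μ) w‖ ≤ L * ‖z - w‖) (hρ : 0 ≤ ρ)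
    (hh₂0 : 0 < h₂) (hh₁ : h₁ ≤ 1 / L) (hh₂ : h₂ ≤ h₁ / 2) (hD : 0 ≤ (L * h₂ ^ 2 - ρ) / L)
    {zstar : Z n m}
    (hMVI : ∀ z, 0 ≤ ⟪smoothedOperator f μ z, z - zstar⟫_ℝ
      + ρ / 2 * ‖smoothedOperator f μ z‖ ^ 2) (z₀ : Z n m) {N : ℕ}
    {uhat u : ℕ → Fin t → Ω → Z n m}
    (huhat : ∀ k ≤ N, ∀ i, HasLaw (uhat k i) (stdGaussian (Z n m)) P)
    (hu : ∀ k ≤ N, ∀ i, HasLaw (u k i) (stdGaussian (Z n m)) P)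
    (hindep : iIndepFun (fun p : (Fin (N + 1) × Fin t) ⊕ (Fin (N + 1) × Fin t) =>
      Sum.elim (fun q => uhat q.1 q.2) (fun q => u q.1 q.2) p) P) :
    ∃ k ≤ N, AEMeasurable (fun ω => iterateHat f μ h₁ h₂ z₀
        (fun j i => uhat j i ω) (fun j i => u j i ω) k) P ∧
      (N + 1) * ((L * h₂ ^ 2 - ρ) / L * ∫ ω, ‖smoothedOperator f μ (iterateHat f μ h₁ h₂ z₀
        (fun j i => uhat j i ω) (fun j i => u j i ω) k)‖ ^ 2 ∂P) ≤
      ‖z₀ - zstar‖ ^ 2 + (N + 1) * ((3 * h₁ * h₂ + h₂ ^ 2) * (σ ^ 2 / t)) := by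
  set x : ℕ → Ω → Z n m := fun k ω =>
    iterate f μ h₁ h₂ z₀ (fun j i => uhat j i ω) (fun j i => u j i ω) k with hx
  have hmem : ∀ k ≤ N + 1, MemLp (x k) 2 P := by
    intro k
    induction k with
    | zero => exact fun _ => memLp_const z₀
    | succ k ih =>
      intro hk
      obtain ⟨_, hlaw, hind⟩ := indepFun_iterate hf μ h₁ h₂ z₀ huhat hu hindep
        (Nat.le_of_succ_le_succ hk)
      exact (integral_sq_norm_step_le hf hμ ht hσ hL hgrad hρ hh₂0 hh₁ hh₂ hD hMVI
        (ih (by omega)) hlaw hind).1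
  obtain ⟨k, hk, hle⟩ := exists_mul_le_of_forall_add_le (N := N)
    (a := fun k => ∫ ω, ‖x k ω - zstar‖ ^ 2 ∂P)
    (b := fun k => ∫ ω, ‖smoothedOperator f μ (iterateHat f μ h₁ h₂ z₀
        (fun j i => uhat j i ω) (fun j i => u j i ω) k)‖ ^ 2 ∂P)
    (D := (L * h₂ ^ 2 - ρ) / L) (c := (3 * h₁ * h₂ + h₂ ^ 2) * (σ ^ 2 / t))
    (fun k => integral_nonneg fun ω => by positivity) fun k hk => by
      obtain ⟨_, hlaw, hind⟩ := indepFun_iterate hf μ h₁ h₂ z₀ huhat hu hindep hk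
      exact (integral_sq_norm_step_le hf hμ ht hσ hL hgrad hρ hh₂0 hh₁ hh₂ hD hMVI
        (hmem k (by omega)) hlaw hind).2
  refine ⟨k, hk, ?_, ?_⟩
  · obtain ⟨hxk, hlaw, _⟩ := indepFun_iterate hf μ h₁ h₂ z₀ huhat hu hindep hk
    exact (measurable_extrapolate hf μ h₁ measurable_fst measurable_snd).comp_aemeasurable
      (hxk.prodMk hlaw.aemeasurable.fst)
  · simpa [hx, iterate] using hle

/-- The arithmetic of the parameter choice: the initial distance contributes at most `ε² / 16` and
the oracle noise at most `7 ε² / 96`. -/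
lemma le_of_parameter_choice {L ρ h₁ h₂ ε σ r b : ℝ} (hL : 0 < L) (hh₂0 : 0 < h₂)
    (hh₁ : h₁ ≤ 1 / L) (hh₂ : h₂ ≤ h₁ / 2) (hD : 0 < L * h₂ ^ 2 - ρ) (hε : 0 < ε) {N t : ℕ}
    (hN : ⌈16 * r ^ 2 * L / (L * h₂ ^ 2 - ρ) * ε⁻¹ ^ 2 - 1⌉ ≤ (N : ℤ)) (ht₀ : 0 < t)
    (ht : ⌈24 * σ ^ 2 / (L * (L * h₂ ^ 2 - ρ)) * ε⁻¹ ^ 2⌉ ≤ (t : ℤ))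
    (hb : (N + 1) * ((L * h₂ ^ 2 - ρ) / L * b) ≤
      r ^ 2 + (N + 1) * ((3 * h₁ * h₂ + h₂ ^ 2) * (σ ^ 2 / t))) :
    b ≤ ε ^ 2 / 4 := by
  set E := L * h₂ ^ 2 - ρ with hE
  have htpos : (0 : ℝ) < t := by exact_mod_cast ht₀
  have hN' : 16 * r ^ 2 ≤ (N + 1) * (E / L * ε ^ 2) := by
    have h1 : 16 * r ^ 2 * L / E * ε⁻¹ ^ 2 - 1 ≤ (N : ℝ) := by exact_mod_cast Int.ceil_le.1 hN
    have h2 : 16 * r ^ 2 * L / E * ε⁻¹ ^ 2 ≤ N + 1 := by linarith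
    have h3 : 16 * r ^ 2 = 16 * r ^ 2 * L / E * ε⁻¹ ^ 2 * (E / L * ε ^ 2) := by field_simp
    rw [h3]
    gcongr
  have ht' : σ ^ 2 / t ≤ L * E * ε ^ 2 / 24 := by
    have h1 : 24 * σ ^ 2 / (L * E) * ε⁻¹ ^ 2 ≤ (t : ℝ) := by exact_mod_cast Int.ceil_le.1 ht
    have h3 : σ ^ 2 = 24 * σ ^ 2 / (L * E) * ε⁻¹ ^ 2 * (L * E * ε ^ 2 / 24) := by field_simp
    rw [div_le_iff₀ htpos, mul_comm _ (t : ℝ), h3]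
    gcongr
  have hh : 3 * h₁ * h₂ + h₂ ^ 2 ≤ 7 / 4 * (1 / L) ^ 2 := by
    have h2 : h₂ ≤ 1 / L / 2 := by linarith
    have h3 : h₁ * h₂ ≤ 1 / L * (1 / L / 2) := mul_le_mul hh₁ h2 hh₂0.le (by positivity)
    have h4 : h₂ ^ 2 ≤ (1 / L / 2) ^ 2 := pow_le_pow_left₀ hh₂0.le h2 2
    calc _ = 3 * (h₁ * h₂) + h₂ ^ 2 := by ring
      _ ≤ 3 * (1 / L * (1 / L / 2)) + (1 / L / 2) ^ 2 := by linarith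
      _ = _ := by ring
  have hc : (3 * h₁ * h₂ + h₂ ^ 2) * (σ ^ 2 / t) ≤ E / L * (7 / 96 * ε ^ 2) := by
    calc _ ≤ 7 / 4 * (1 / L) ^ 2 * (L * E * ε ^ 2 / 24) :=
          mul_le_mul hh ht' (by positivity) (by positivity)
      _ = _ := by field_simp; norm_num
  have hN0 : (0 : ℝ) < N + 1 := by positivity
  have hEL : 0 < E / L := by positivity
  have h1 : (N + 1 : ℝ) * ((3 * h₁ * h₂ + h₂ ^ 2) * (σ ^ 2 / t)) ≤
      (N + 1) * (E / L * (7 / 96 * ε ^ 2)) := mul_le_mul_of_nonneg_left hc hN0.le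
  have h2 : (N + 1 : ℝ) * (E / L * b) ≤ (N + 1) * (E / L * (13 / 96 * ε ^ 2)) := by
    have : (N + 1 : ℝ) * (E / L * (13 / 96 * ε ^ 2)) =
      (N + 1) * (E / L * ε ^ 2) / 16 + (N + 1) * (E / L * (7 / 96 * ε ^ 2)) := by ring
    linarith
  have h3 := le_of_mul_le_mul_left (le_of_mul_le_mul_left h2 hN0) hEL
  nlinarith [sq_nonneg ε]

/-- A random point at which the expected squared norm of `F_μ` is at most `ε² / 4` is
`(δ, ε)`-Goldstein stationary in expectation. -/
lemma isGoldsteinStationaryInExpectation_of_integral_le (hd : 0 < n + m) (hf : LipschitzWith C f)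
    (hC : 0 < C) {μ δ ε L : ℝ} (hμ : 0 < μ)
    (hgrad : ∀ z w, ‖∇ (smoothed f μ) z - ∇ (smoothed f μ) w‖ ≤ L * ‖z - w‖)
    (hδ : 0 < δ) (hε : 0 < ε)
    (hμδ : μ ≤ δ / √((n + m : ℕ) * Real.pi * Real.exp 1)
      * (ε / (8 * C)) ^ (1 / ((n + m : ℕ) : ℝ)))
    {X : Ω → Z n m} (hX : AEMeasurable X P)
    (hb : ∫ ω, ‖smoothedOperator f μ (X ω)‖ ^ 2 ∂P ≤ ε ^ 2 / 4) :
    IsGoldsteinStationaryInExpectation P f δ ε X := by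
  refine ⟨(lowerSemicontinuous_goldsteinResidual hf hδ).measurable.comp_aemeasurable hX, ?_⟩
  have hFm : AEStronglyMeasurable (fun ω => smoothedOperator f μ (X ω)) P :=
    ((continuous_smoothedOperator hgrad).measurable.comp_aemeasurable hX).aestronglyMeasurable
  have hF2 : MemLp (fun ω => smoothedOperator f μ (X ω)) 2 P :=
    MemLp.of_bound hFm C (ae_of_all _ fun ω => by
      rw [norm_smoothedOperator]; exact norm_gradient_smoothed_le hf hμ.ne' _)
  have hint : Integrable (fun ω => ‖smoothedOperator f μ (X ω)‖) P :=
    (hF2.integrable one_le_two).norm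
  have hint2 : Integrable (fun ω => ‖smoothedOperator f μ (X ω)‖ ^ 2) P :=
    hF2.integrable_norm_pow two_ne_zero
  -- `‖F‖ ≤ ‖F‖² / ε + ε / 4` pointwise replaces the Cauchy–Schwarz inequality
  have h1 : ∫ ω, ‖smoothedOperator f μ (X ω)‖ ∂P ≤
      ∫ ω, (ε⁻¹ * ‖smoothedOperator f μ (X ω)‖ ^ 2 + ε / 4) ∂P := by
    refine integral_mono hint ((hint2.const_mul _).add (integrable_const _)) fun ω => ?_
    have h2 : ε⁻¹ * ‖smoothedOperator f μ (X ω)‖ ^ 2 + ε / 4 - ‖smoothedOperator f μ (X ω)‖ =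
        ε⁻¹ * (‖smoothedOperator f μ (X ω)‖ - ε / 2) ^ 2 := by field_simp; ring
    have h3 : 0 ≤ ε⁻¹ * (‖smoothedOperator f μ (X ω)‖ - ε / 2) ^ 2 := by positivity
    change ‖smoothedOperator f μ (X ω)‖ ≤ ε⁻¹ * ‖smoothedOperator f μ (X ω)‖ ^ 2 + ε / 4
    linarith
  rw [integral_add (hint2.const_mul _) (integrable_const _), integral_const_mul] at h1
  have h4 : ε⁻¹ * ∫ ω, ‖smoothedOperator f μ (X ω)‖ ^ 2 ∂P ≤ ε⁻¹ * (ε ^ 2 / 4) := by gcongr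
  have h5 : ε⁻¹ * (ε ^ 2 / 4) = ε / 4 := by field_simp
  simp only [integral_const, probReal_univ, one_smul] at h1
  calc ∫⁻ ω, goldsteinResidual f δ (X ω) ∂P
      ≤ ∫⁻ ω, ENNReal.ofReal (‖smoothedOperator f μ (X ω)‖ + ε / 4) ∂P :=
        lintegral_mono fun ω => goldsteinResidual_le hd hf hC hμ hδ hε hμδ (X ω)
    _ = ENNReal.ofReal (∫ ω, (‖smoothedOperator f μ (X ω)‖ + ε / 4) ∂P) :=
        (ofReal_integral_eq_lintegral_ofReal (hint.add (integrable_const _))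
          (ae_of_all _ fun ω => by
            change 0 ≤ ‖smoothedOperator f μ (X ω)‖ + ε / 4
            positivity)).symm
    _ ≤ ENNReal.ofReal ε := by
        refine ENNReal.ofReal_le_ofReal ?_
        rw [integral_add hint (integrable_const _)]
        simp only [integral_const, probReal_univ, one_smul]
        linarith

end ZOEG

theorem mainTheorem7 {n m : ℕ} (hd : 0 < n + m)
    -- the Lipschitz objective function and its Gaussian smoothing
    (f : ZOEG.Z n m → ℝ) (L₀ : ℝ) (hL₀ : 0 < L₀) (hf : ∀ z w, |f z - f w| ≤ L₀ * ‖z - w‖)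
    (μ : ℝ) (hμ : 0 < μ)
    -- a Lipschitz constant of the gradient of the smoothed function
    (L₁ : ℝ) (hL₁ : 0 < L₁)
    (hgrad : ∀ z w, ‖∇ (ZOEG.smoothed f μ) z - ∇ (ZOEG.smoothed f μ) w‖ ≤ L₁ * ‖z - w‖)
    -- an upper bound on the variance of the oracle
    (σ : ℝ) (hσ : ∀ z, ∫ u, ‖ZOEG.oracle f μ z u - ZOEG.smoothedOperator f μ z‖ ^ 2
      ∂(stdGaussian (ZOEG.Z n m)) ≤ σ ^ 2)
    -- a solution of the weak Minty variational inequality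
    (ρ : ℝ) (hρ₀ : 0 ≤ ρ) (hρ : ρ < 1 / (4 * L₁)) (zstar : ZOEG.Z n m)
    (hMVI : ∀ z, 0 ≤ ⟪ZOEG.smoothedOperator f μ z, z - zstar⟫_ℝ
      + ρ / 2 * ‖ZOEG.smoothedOperator f μ z‖ ^ 2)
    -- the parameters of the method
    (δ ε : ℝ) (hδ₀ : 0 < δ) (hδ₁ : δ < 1) (hε : 0 < ε)
    (hμδ : μ ≤ δ / √((n + m : ℕ) * Real.pi * Real.exp 1)
      * (ε / (8 * L₀)) ^ (1 / ((n + m : ℕ) : ℝ)))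
    (h₁ h₂ : ℝ) (hh₁ : h₁ ≤ 1 / L₁) (hh₂ : √(ρ / L₁) < h₂) (hh₂' : h₂ ≤ h₁ / 2)
    (z₀ : ZOEG.Z n m) (N : ℕ)
    (hN : ⌈16 * ‖z₀ - zstar‖ ^ 2 * L₁ / (L₁ * h₂ ^ 2 - ρ) * ε⁻¹ ^ 2 - 1⌉ ≤ (N : ℤ))
    (t : ℕ) (ht₀ : 0 < t)
    (ht : ⌈24 * σ ^ 2 / (L₁ * (L₁ * h₂ ^ 2 - ρ)) * ε⁻¹ ^ 2⌉ ≤ (t : ℤ))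
    -- the independent standard Gaussian directions
    {Ω : Type*} [MeasurableSpace Ω] (P : Measure Ω) [IsProbabilityMeasure P]
    (uhat u : ℕ → Fin t → Ω → ZOEG.Z n m)
    (huhat : ∀ k ≤ N, ∀ i, HasLaw (uhat k i) (stdGaussian (ZOEG.Z n m)) P)
    (hu : ∀ k ≤ N, ∀ i, HasLaw (u k i) (stdGaussian (ZOEG.Z n m)) P)
    (hindep : iIndepFun (fun p : (Fin (N + 1) × Fin t) ⊕ (Fin (N + 1) × Fin t) =>
      Sum.elim (fun q => uhat q.1 q.2) (fun q => u q.1 q.2) p) P) :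
    (∀ z w, ‖∇ (ZOEG.smoothed f μ) z - ∇ (ZOEG.smoothed f μ) w‖
      ≤ √(n + m : ℕ) / μ * L₀ * ‖z - w‖) ∧
    ∃ k ≤ N, ZOEG.IsGoldsteinStationaryInExpectation P f δ ε
      (fun ω => ZOEG.iterateHat f μ h₁ h₂ z₀
        (fun j i => uhat j i ω) (fun j i => u j i ω) k) := by


  have hf' : LipschitzWith L₀.toNNReal f := LipschitzWith.of_dist_le' fun z w => by
    rw [Real.dist_eq, dist_eq_norm]; exact hf z w
  have hC : ((L₀.toNNReal : NNReal) : ℝ) = L₀ := Real.coe_toNNReal _ hL₀.le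
  refine ⟨fun z w => ?_, ?_⟩
  · have h := ZOEG.norm_gradient_smoothed_sub_le hf' hμ z w
    rwa [hC] at h
  have hh₂0 : 0 < h₂ := (Real.sqrt_nonneg _).trans_lt hh₂
  have hD : 0 < L₁ * h₂ ^ 2 - ρ := by
    have h1 : ρ / L₁ < h₂ ^ 2 := (Real.sqrt_lt' hh₂0).1 hh₂
    rw [div_lt_iff₀ hL₁] at h1
    linarith
  obtain ⟨k, hk, hmeas, hle⟩ := ZOEG.exists_integral_sq_norm_smoothedOperator_le hf' hμ ht₀ hσ hL₁
    hgrad hρ₀ hh₂0 hh₁ hh₂' (div_pos hD hL₁).le hMVI z₀ huhat hu hindep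
  refine ⟨k, hk, ?_⟩
  exact ZOEG.isGoldsteinStationaryInExpectation_of_integral_le hd hf' (Real.toNNReal_pos.2 hL₀) hμ
    hgrad hδ₀ hε (by rwa [hC]) hmeas
    (ZOEG.le_of_parameter_choice hL₁ hh₂0 hh₁ hh₂' hD hε hN ht₀ ht hle)
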